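/- Let $\pi : P \to M$ be a smooth principal $\mathbb{R}^\times$-bundle ($\mathbb{R}^\times = \mathbb{R}\setminus\{0\}$) over an oriented smooth manifold $M$ of dimension $n \ge 0$, and let $\Delta_P$ be its Euler vector field, i.e. the fundamental vector field of the $\mathbb{R}^\times$-action, $\Delta_P|_p = \frac{d}{ds}\big|_{s=0} e^{s}\cdot p$. Let $g$ be a smooth symmetric positive semidefinite covariant 2-tensor on $P$ whose kernel at every point is the vertical space $\ker d\pi$ (a degenerate metric of signature $(1,\dots,1,0)$), and let $\theta \in \Omega^1(P)$ be the connection one-form of a principal connection, i.e. $\theta$ is $\mathbb{R}^\times$-invariant and $\theta(\Delta_P) = 1$. Put $G := g - \theta\otimes\theta$, a Lorentzian metric on $P$, and let $\mathsf{Vol}_P = (-1)^n\,\theta\wedge\mathsf{Vol}_M$ be the metric volume form of $G$ for the orientation of $P$ determined by $(-1)^n\,\theta\wedge\pi^*\omega$, where $\omega$ is any top-degree form representing the orientation of $M$; thus $\mathsf{Vol}_P(e_1,\dots,e_n,\Delta_P)=1$ whenever $e_1,\dots,e_n$ are $g$-orthonormal and project to a positively oriented basis of the tangent space of $M$. For $0\le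 k\le n+1$ and $\xi\in\Omega^k(P)$ let $\star\xi$ be the form of degree $n+1-k$ with $\eta\wedge\star\xi = \langle\eta,\xi\rangle_G\,\mathsf{Vol}_P$ for all $k$-forms $\eta$, where $\langle\cdot,\cdot\rangle_G$ is the pointwise inner product induced by $G$. Suppose that $\Delta_P$ is Killing for $g$, i.e. $\mathcal{L}_{\Delta_P} g = 0$. Then: 1. $\Delta_P$ is Killing for $G$: $\mathcal{L}_{\Delta_P}G = 0$; 2. for every $0\le k\le n+1$ and every $\xi\in\Omega^k(P)$, the form $\star\xi$ exists, is unique and is smooth, and $\mathcal{L}_{\Delta_P}(\star\xi) = \star\,\mathcal{L}_{\Delta_P}\xi$; 3. consequently, if $\xi\in\Omega^k(P)$ is homogeneous of weight $\lambda\in\mathbb{R}$, i.e. $\mathcal{L}_{\Delta_P}\xi = \lambda\,\xi$, then $\star\xi$ is also homogeneous of weight $\lambda$: $\mathcal{L}_{\Delta_P}(\star\xi)=\lambda\star\xi$. -/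

import Mathlib

open scoped Manifold ContDiff

noncomputable section

namespace Carroll

/-! ### Linear algebra of alternating forms on a vector space -/

section LinearAlgebra

variable {V : Type*} [AddCommGroup V] [Module ℝ V]

/-- The exterior product `η ∧ ζ` of a `k`-form and an `l`-form, as a form of degree `m = k + l`:
the signed sum over `(k, l)`-shuffles, so that `(α ∧ β) (u, v) = α u * β v - α v * β u` for
one-forms. -/
def wedge {k l m : ℕ} (h : k + l = m) (η : V [⋀^Fin k]→ₗ[ℝ] ℝ) (ζ : V [⋀^Fin l]→ₗ[ℝ] ℝ) :
    V [⋀^Fin m]→ₗ[ℝ] ℝ :=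
  ((LinearMap.mul' ℝ ℝ).compAlternatingMap (η.domCoprod ζ)).domDomCongr
    (finSumFinEquiv.trans (finCongr h))

/-- The Gram matrix `B (b i) (b j)` of a bilinear form `B` in a basis `b`. -/
def gram {m : ℕ} (B : V → V → ℝ) (b : Module.Basis (Fin m) ℝ V) : Matrix (Fin m) (Fin m) ℝ :=
  Matrix.of fun i j => B (b i) (b j)

/-- The inner product induced on `k`-forms by a nondegenerate symmetric bilinear form `B`:
`(1 / k!) B^{i₁ j₁} ⋯ B^{i_k j_k} η_{i₁ … i_k} ξ_{j₁ … j_k}`, where `B^{i j}` is the inverse of the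
matrix of `B` in the basis `b`.  The value does not depend on `b`. -/
def formInner {m k : ℕ} (B : V → V → ℝ) (b : Module.Basis (Fin m) ℝ V)
    (η ξ : V [⋀^Fin k]→ₗ[ℝ] ℝ) : ℝ :=
  ((k.factorial : ℝ))⁻¹ * ∑ f : Fin k → Fin m, ∑ h : Fin k → Fin m,
    (∏ i, (gram B b)⁻¹ (f i) (h i)) * η (fun i => b (f i)) * ξ (fun i => b (h i))

/-- The metric volume form of a nondegenerate symmetric bilinear form `B`, for the orientation given
by the nonzero top-degree form `ζ`: the positive multiple of `ζ` whose value on the basis `b` has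
absolute value `√|det B (b i) (b j)|`.  It does not depend on `b`, nor on the choice of `ζ` up to a
positive factor, and takes the values `±1` on `B`-orthonormal bases. -/
def volumeForm {m : ℕ} (B : V → V → ℝ) (b : Module.Basis (Fin m) ℝ V) (ζ : V [⋀^Fin m]→ₗ[ℝ] ℝ) :
    V [⋀^Fin m]→ₗ[ℝ] ℝ :=
  (√|(gram B b).det| / |ζ b|) • ζ

end LinearAlgebra

/-! ### Tensor fields and the Lie derivative -/

section Tensors

variable {m : ℕ} {P : Type*} [TopologicalSpace P] [ChartedSpace (EuclideanSpace ℝ (Fin m)) P]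

variable (m P) in
/-- A (not necessarily smooth) vector field on the `m`-dimensional manifold `P`. -/
abbrev VField : Type _ := ∀ p : P, TangentSpace (𝓡 m) p

variable (m P) in
/-- A (not necessarily smooth) covariant tensor field of rank `k`. -/
abbrev TensorField (k : ℕ) : Type _ :=
  ∀ p : P, ContinuousMultilinearMap ℝ (fun _ : Fin k => TangentSpace (𝓡 m) p) ℝ

variable (m P) in
/-- A (not necessarily smooth) field of alternating `k`-forms. -/
abbrev FormField (k : ℕ) : Type _ :=
  ∀ p : P, (TangentSpace (𝓡 m) p) [⋀^Fin k]→L[ℝ] ℝ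

/-- A form field, seen as a covariant tensor field. -/
def FormField.toTensor {k : ℕ} (ξ : FormField m P k) : TensorField m P k :=
  fun p => (ξ p).toContinuousMultilinearMap

/-- The coordinate expression of a vector field in the preferred chart at `p₀`. -/
def coordVField (X : VField m P) (p₀ : P) (y : EuclideanSpace ℝ (Fin m)) :
    EuclideanSpace ℝ (Fin m) :=
  mfderiv (𝓡 m) 𝓘(ℝ, EuclideanSpace ℝ (Fin m)) (extChartAt (𝓡 m) p₀)
    ((extChartAt (𝓡 m) p₀).symm y) (X ((extChartAt (𝓡 m) p₀).symm y))

/-- The coordinate expression of a covariant tensor field in the preferred chart at `p₀`: its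
pull-back by the inverse of the chart. -/
def coordTensor {k : ℕ} (T : TensorField m P k) (p₀ : P) (y : EuclideanSpace ℝ (Fin m)) :
    ContinuousMultilinearMap ℝ (fun _ : Fin k => EuclideanSpace ℝ (Fin m)) ℝ :=
  (T ((extChartAt (𝓡 m) p₀).symm y)).compContinuousLinearMap fun _ =>
    (mfderiv 𝓘(ℝ, EuclideanSpace ℝ (Fin m)) (𝓡 m) (extChartAt (𝓡 m) p₀).symm y :)

/-- A covariant tensor field is smooth if all its coordinate expressions are. -/
def TensorField.Smooth {k : ℕ} (T : TensorField m P k) : Prop :=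
  ∀ p₀ : P, ContDiffOn ℝ ∞ (coordTensor T p₀) (extChartAt (𝓡 m) p₀).target

/-- Smoothness of a form field: `ξ ∈ Ω^k(P)`. -/
def FormField.Smooth {k : ℕ} (ξ : FormField m P k) : Prop :=
  TensorField.Smooth ξ.toTensor

/-- The Lie derivative on an open set of Euclidean space:
`(L_X T)(w₁, …, w_k) = (D_X T)(w₁, …, w_k) + ∑ i, T (w₁, …, DX(w_i), …, w_k)`. -/
def coordLieDeriv {k : ℕ} (X : EuclideanSpace ℝ (Fin m) → EuclideanSpace ℝ (Fin m))
    (T : EuclideanSpace ℝ (Fin m) →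
      ContinuousMultilinearMap ℝ (fun _ : Fin k => EuclideanSpace ℝ (Fin m)) ℝ)
    (y : EuclideanSpace ℝ (Fin m)) :
    ContinuousMultilinearMap ℝ (fun _ : Fin k => EuclideanSpace ℝ (Fin m)) ℝ :=
  fderiv ℝ T y (X y) + ∑ i : Fin k, (T y).compContinuousLinearMap
    (Function.update (fun _ => ContinuousLinearMap.id ℝ (EuclideanSpace ℝ (Fin m))) i
      (fderiv ℝ X y))

/-- The Lie derivative `L_X T` of a covariant tensor field along a vector field, computed at each
point `p` in the preferred chart at `p`. -/
def lieDeriv {k : ℕ} (X : VField m P) (T : TensorField m P k) : TensorField m P k := fun p =>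
  (coordLieDeriv (coordVField X p) (coordTensor T p)
    (extChartAt (𝓡 m) p p)).compContinuousLinearMap fun _ =>
      (mfderiv (𝓡 m) 𝓘(ℝ, EuclideanSpace ℝ (Fin m)) (extChartAt (𝓡 m) p) p :)

theorem coordLieDeriv_apply {k : ℕ} (X : EuclideanSpace ℝ (Fin m) → EuclideanSpace ℝ (Fin m))
    (T : EuclideanSpace ℝ (Fin m) →
      ContinuousMultilinearMap ℝ (fun _ : Fin k => EuclideanSpace ℝ (Fin m)) ℝ)
    (y : EuclideanSpace ℝ (Fin m)) (w : Fin k → EuclideanSpace ℝ (Fin m)) :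
    coordLieDeriv X T y w = fderiv ℝ T y (X y) w +
      ∑ i, T y (Function.update w i (fderiv ℝ X y (w i))) := by
  have h : ∀ i : Fin k, (fun j => (Function.update
      (fun _ => ContinuousLinearMap.id ℝ (EuclideanSpace ℝ (Fin m))) i (fderiv ℝ X y)
        : Fin k → _) j (w j)) = Function.update w i (fderiv ℝ X y (w i)) := by
    intro i
    funext j
    by_cases hj : j = i
    · subst hj; simp
    · simp [hj]
  simp [coordLieDeriv, h]

/-- The coordinate formula for the Lie derivative preserves alternating tensors. -/
theorem coordLieDeriv_alternating {k : ℕ}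
    (X : EuclideanSpace ℝ (Fin m) → EuclideanSpace ℝ (Fin m))
    (T : EuclideanSpace ℝ (Fin m) →
      ContinuousMultilinearMap ℝ (fun _ : Fin k => EuclideanSpace ℝ (Fin m)) ℝ)
    (hT : ∀ y (w : Fin k → EuclideanSpace ℝ (Fin m)) (i j : Fin k), w i = w j → i ≠ j → T y w = 0)
    (y : EuclideanSpace ℝ (Fin m)) (w : Fin k → EuclideanSpace ℝ (Fin m)) (i j : Fin k)
    (hw : w i = w j) (hij : i ≠ j) : coordLieDeriv X T y w = 0 := by
  rw [coordLieDeriv_apply]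
  have h1 : fderiv ℝ T y (X y) w = 0 := by
    by_cases hd : DifferentiableAt ℝ T y
    · have h := (hd.hasFDerivAt.continuousMultilinear_apply_const w).unique
        (by simpa [hT _ w i j hw hij] using hasFDerivAt_const (0 : ℝ) y)
      simpa using congrArg (fun L => L (X y)) h
    · simp [fderiv_zero_of_not_differentiableAt hd]
  set A := fderiv ℝ X y
  let F : EuclideanSpace ℝ (Fin m) [⋀^Fin k]→ₗ[ℝ] ℝ :=
    { (T y).toMultilinearMap with map_eq_zero_of_eq' := fun v a b => hT y v a b }
  have hF : ∀ v, T y v = F v := fun v => rfl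
  have h2 : ∑ a, T y (Function.update w a (A (w a))) =
      ∑ a ∈ ({i, j} : Finset (Fin k)), T y (Function.update w a (A (w a))) := by
    symm
    apply Finset.sum_subset (Finset.subset_univ _)
    intro a _ ha
    simp only [Finset.mem_insert, Finset.mem_singleton, not_or] at ha
    apply hT y _ i j _ hij
    simp [Function.update_of_ne (Ne.symm ha.1), Function.update_of_ne (Ne.symm ha.2), hw]
  have h3 : Function.update w j (A (w j)) =
      Function.update w i (A (w i)) ∘ Equiv.swap i j := by
    funext a
    by_cases hai : a = i
    · subst hai; simp [Function.update_of_ne hij, Function.update_of_ne hij.symm, hw]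
    · by_cases haj : a = j
      · subst haj; simp [hw]
      · simp [hai, haj, Equiv.swap_apply_of_ne_of_ne hai haj]
  rw [h1, h2, Finset.sum_pair hij, h3, hF, hF, F.map_swap _ hij]
  simp

/-- The Lie derivative of a form field is alternating. -/
theorem lieDeriv_alternating {k : ℕ} (X : VField m P) (ξ : FormField m P k) (p : P)
    (v : Fin k → TangentSpace (𝓡 m) p) (i j : Fin k) (hv : v i = v j) (hij : i ≠ j) :
    lieDeriv X ξ.toTensor p v = 0 := by
  have h := coordLieDeriv_alternating (coordVField X p) (coordTensor ξ.toTensor p)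
    (fun y w i j hw hij => (ξ ((extChartAt (𝓡 m) p).symm y)).map_eq_zero_of_eq
      (fun a => mfderiv 𝓘(ℝ, EuclideanSpace ℝ (Fin m)) (𝓡 m) (extChartAt (𝓡 m) p).symm y (w a))
      (by rw [hw]) hij) (extChartAt (𝓡 m) p p)
  exact h (fun a => mfderiv (𝓡 m) 𝓘(ℝ, EuclideanSpace ℝ (Fin m)) (extChartAt (𝓡 m) p) p (v a))
    i j (by rw [hv]) hij

/-- The Lie derivative `L_X ξ` of a differential form. -/
def lieDerivForm {k : ℕ} (X : VField m P) (ξ : FormField m P k) : FormField m P k := fun p =>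
  { lieDeriv X ξ.toTensor p with
    map_eq_zero_of_eq' := lieDeriv_alternating X ξ p }

/-- `X` is a Killing vector field for the (possibly degenerate) metric `g`. -/
def IsKilling (X : VField m P) (g : TensorField m P 2) : Prop :=
  lieDeriv X g = 0

/-- `ξ` is homogeneous of weight `c` with respect to the vector field `X`: `L_X ξ = c ξ`. -/
def IsHomogeneous {k : ℕ} (X : VField m P) (c : ℝ) (ξ : FormField m P k) : Prop :=
  lieDerivForm X ξ = c • ξ

end Tensors

/-! ### Principal bundles, connections and degenerate metrics -/

section Bundle

variable {n : ℕ} {M P : Type*}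
  [TopologicalSpace M] [ChartedSpace (EuclideanSpace ℝ (Fin n)) M]
  [TopologicalSpace P] [ChartedSpace (EuclideanSpace ℝ (Fin (n + 1))) P]

variable (n) in
/-- `π : P → M` is a smooth principal bundle with structure group `ℝˣ`, where `dim M = n` and
`dim P = n + 1`: the action is smooth, it preserves the fibres, and there are smooth equivariant
local trivialisations `π⁻¹(U) ≃ U × ℝˣ` around every point of `M`. -/
structure IsPrincipalBundle [MulAction ℝˣ P] (π : P → M) : Prop where
  smooth_smul : ContMDiff (𝓘(ℝ, ℝ).prod (𝓡 (n + 1))) (𝓡 (n + 1)) ∞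
    (fun a : ℝˣ × P => a.1 • a.2)
  proj_smul : ∀ (a : ℝˣ) (p : P), π (a • p) = π p
  exists_trivialization : ∀ x : M, ∃ e : Bundle.Trivialization ℝˣ π, x ∈ e.baseSet ∧
    ContMDiffOn (𝓡 (n + 1)) ((𝓡 n).prod 𝓘(ℝ, ℝ)) ∞ e e.source ∧
    ContMDiffOn ((𝓡 n).prod 𝓘(ℝ, ℝ)) (𝓡 (n + 1)) ∞ e.toOpenPartialHomeomorph.symm e.target ∧
    ∀ (a : ℝˣ), ∀ p ∈ e.source, (e (a • p)).2 = a * (e p).2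

variable (n P) in
/-- The Euler vector field: the fundamental vector field of the action of `ℝˣ`, i.e. the velocity
at `s = 0` of the curves `s ↦ exp(s) • p`. -/
def euler [MulAction ℝˣ P] : VField (n + 1) P := fun p =>
  mfderiv 𝓘(ℝ, ℝ) (𝓡 (n + 1))
    (fun s : ℝ => Units.mk0 (Real.exp s) (Real.exp_ne_zero s) • p) 0 (1 : ℝ)

/-- A degenerate metric of signature `(1, …, 1, 0)` on `P` whose kernel is the vertical bundle: a
smooth symmetric positive semidefinite covariant `2`-tensor `g` with `ker g = ker dπ`. -/
structure IsCarrollianMetric (π : P → M) (g : TensorField (n + 1) P 2) : Prop where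
  smooth : g.Smooth
  symm : ∀ p v w, g p ![v, w] = g p ![w, v]
  nonneg : ∀ p v, 0 ≤ g p ![v, v]
  ker : ∀ p v, (∀ w, g p ![v, w] = 0) ↔ mfderiv (𝓡 (n + 1)) (𝓡 n) π p v = 0

/-- The one-form `θ` of a principal connection: a smooth `ℝˣ`-invariant one-form on `P` with
`θ(Δ) = 1` for the Euler vector field `Δ`. -/
structure IsConnectionForm [MulAction ℝˣ P] (θ : FormField (n + 1) P 1) : Prop where
  smooth : θ.Smooth
  euler : ∀ p, θ p ![euler n P p] = 1
  invariant : ∀ (a : ℝˣ) (p : P) (v : TangentSpace (𝓡 (n + 1)) p),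
    θ (a • p) ![mfderiv (𝓡 (n + 1)) (𝓡 (n + 1)) (fun q : P => a • q) p v] = θ p ![v]

/-- A pointwise choice of orientations of the tangent spaces of `M` is an orientation of the
manifold if it is locally constant in charts: near each `x₀`, the orientation at `x` is represented
by the pull-back, under the differential of the chart at `x₀`, of a fixed top-degree form
representing the orientation at `x₀`. -/
def IsManifoldOrientation (o : ∀ x : M, Orientation ℝ (TangentSpace (𝓡 n) x) (Fin n)) : Prop :=
  ∀ x₀ : M, ∀ᶠ x in nhds x₀, SameRay ℝ (o x).someVector
    ((show EuclideanSpace ℝ (Fin n) [⋀^Fin n]→ₗ[ℝ] ℝ from (o x₀).someVector).compLinearMap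
      (mfderiv (𝓡 n) 𝓘(ℝ, EuclideanSpace ℝ (Fin n)) (extChartAt (𝓡 n) x₀) x).toLinearMap)

/-- The tensor product `θ ⊗ θ` of a one-form with itself: `(v, w) ↦ θ(v) θ(w)`. -/
def tensorSq {m : ℕ} {Q : Type*} [TopologicalSpace Q] [ChartedSpace (EuclideanSpace ℝ (Fin m)) Q]
    (θ : FormField m Q 1) : TensorField m Q 2 := fun p =>
  (ContinuousMultilinearMap.mkPiAlgebra ℝ (Fin 2) ℝ).compContinuousLinearMap
    fun _ => (ContinuousAlternatingMap.ofSubsingleton ℝ (TangentSpace (𝓡 m) p) ℝ (0 : Fin 1)).symm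
      (θ p)

/-- The Lorentzian metric `G = g - θ ⊗ θ`. -/
def lorentzMetric {m : ℕ} {Q : Type*} [TopologicalSpace Q]
    [ChartedSpace (EuclideanSpace ℝ (Fin m)) Q]
    (g : TensorField m Q 2) (θ : FormField m Q 1) : TensorField m Q 2 :=
  g - tensorSq θ

/-- The standard basis of a tangent space (the one of the preferred chart at the point). -/
def stdBasis {m : ℕ} {Q : Type*} [TopologicalSpace Q]
    [ChartedSpace (EuclideanSpace ℝ (Fin m)) Q] (p : Q) :
    Module.Basis (Fin m) ℝ (TangentSpace (𝓡 m) p) :=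
  (EuclideanSpace.basisFun (Fin m) ℝ).toBasis

/-- The pointwise inner product `⟨η, ξ⟩_G` of `k`-forms at `p` induced by the metric `G`. -/
def innerAt {m k : ℕ} {Q : Type*} [TopologicalSpace Q]
    [ChartedSpace (EuclideanSpace ℝ (Fin m)) Q] (G : TensorField m Q 2) (p : Q)
    (η ξ : (TangentSpace (𝓡 m) p) [⋀^Fin k]→L[ℝ] ℝ) : ℝ :=
  formInner (fun v w => G p ![v, w]) (stdBasis p) η.toAlternatingMap ξ.toAlternatingMap

/-- The volume form `Vol_P = (-1)^n θ ∧ Vol_M`, written as the metric volume form of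
`G = g - θ ⊗ θ` for the orientation of `P` given by `(-1)^n θ ∧ π^* ζ`, where `ζ` is any top-degree
form representing the orientation of `M`.  If `e₁, …, e_n` are `g`-orthonormal and project to a
positively oriented basis of the tangent space of `M`, its value on `(e₁, …, e_n, Δ)` is `1`. -/
def volP (π : P → M) (g : TensorField (n + 1) P 2) (θ : FormField (n + 1) P 1)
    (o : ∀ x : M, Orientation ℝ (TangentSpace (𝓡 n) x) (Fin n)) (p : P) :
    (TangentSpace (𝓡 (n + 1)) p) [⋀^Fin (n + 1)]→ₗ[ℝ] ℝ :=
  volumeForm (fun v w => lorentzMetric g θ p ![v, w]) (stdBasis p)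
    ((-1 : ℝ) ^ n • wedge (Nat.add_comm 1 n) (θ p).toAlternatingMap
      ((o (π p)).someVector.compLinearMap (mfderiv (𝓡 (n + 1)) (𝓡 n) π p).toLinearMap))

/-- The defining property of the Hodge dual `ζ = ⋆ξ`, an `l`-form with `k + l = n + 1`:
`η ∧ ζ = ⟨η, ξ⟩_G Vol_P` for all `k`-forms `η`, at every point. -/
def IsHodgeDual (π : P → M) (g : TensorField (n + 1) P 2) (θ : FormField (n + 1) P 1)
    (o : ∀ x : M, Orientation ℝ (TangentSpace (𝓡 n) x) (Fin n)) {k l : ℕ} (h : k + l = n + 1)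
    (ξ : FormField (n + 1) P k) (ζ : FormField (n + 1) P l) : Prop :=
  ∀ (p : P) (η : (TangentSpace (𝓡 (n + 1)) p) [⋀^Fin k]→L[ℝ] ℝ),
    wedge h η.toAlternatingMap (ζ p).toAlternatingMap =
      innerAt (lorentzMetric g θ) p η (ξ p) • volP π g θ o p

/-- The Hodge star operator `⋆` from `k`-forms to `l`-forms, `k + l = n + 1`: `⋆ξ` is the form with
the defining property `IsHodgeDual`. -/
def hodgeStar (π : P → M) (g : TensorField (n + 1) P 2) (θ : FormField (n + 1) P 1)
    (o : ∀ x : M, Orientation ℝ (TangentSpace (𝓡 n) x) (Fin n)) {k l : ℕ} (h : k + l = n + 1)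
    (ξ : FormField (n + 1) P k) : FormField (n + 1) P l :=
  Classical.epsilon (IsHodgeDual π g θ o h ξ)

end Bundle

end Carroll

end

/-!
The Hodge star at a point is determined by the metric, the orientation and the form, and it is
natural under linear isomorphisms (`IsHodgeAt.pullback`).  Its components are given by
`(⋆ξ)(u) = ⟨D(·, u), ξ⟩ √|det G| ε`, where `D` is the determinant of the coordinate basis, `u` a
tuple of basis vectors and `ε` the sign of the orientation (`IsHodgeAt.apply_basis`); conversely,
contracting the volume form with `ξ` after raising its indices gives a dual form
(`exists_isHodgeAt`).  So `⋆ξ` exists and is unique, and it is smooth because `G` is nondegenerate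
(`det_gram_lorentzMetric_ne_zero`, from `ker dπ = ℝ Δ`) and `ε` is locally constant
(`eventually_orientSign`).

For the Lie derivative no flow is needed.  In a chart, `L_X T` at `y` is the derivative at `t = 0`
of `T(y + t X(y))` pulled back by the linear map `1 + t DX(y)` (`hasDerivAt_coordLieDeriv`).  By
naturality, the pulled back forms `ξ_t` and `(⋆ξ)_t` are Hodge dual for the pulled back metric
`G_t`.  If `X` is Killing then the derivative of `G_t` at `t = 0` vanishes, hence so do those of its
inverse and of `√|det G_t|`; differentiating the component formula shows that `L_X ⋆ξ` is the Hodge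
dual of `L_X ξ` (`IsHodgeDual.lieDeriv`).

The Euler field is Killing for `G = g - θ ⊗ θ` because it is Killing for `g` and because
differentiating the invariance of `θ` gives `L_Δ θ = 0` (`lieDeriv_euler_connection`).
-/

namespace Carroll

noncomputable section

/-! ### Exterior products and contractions -/

section Wedge

variable {V W : Type*} [AddCommGroup V] [Module ℝ V] [AddCommGroup W] [Module ℝ W]
  {k l m : ℕ}

/-- The identification of the index set of a form of degree `m = k + l` with the disjoint union of
the index sets of forms of degrees `k` and `l`. -/
def sumIndex (h : k + l = m) : Fin k ⊕ Fin l ≃ Fin m :=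
  finSumFinEquiv.trans (finCongr h)

theorem mul'_summand_mk (η : V [⋀^Fin k]→ₗ[ℝ] ℝ) (ζ : V [⋀^Fin l]→ₗ[ℝ] ℝ)
    (σ : Equiv.Perm (Fin k ⊕ Fin l)) (v : Fin k ⊕ Fin l → V) :
    LinearMap.mul' ℝ ℝ (AlternatingMap.domCoprod.summand η ζ (Quotient.mk'' σ) v) =
      (Equiv.Perm.sign σ : ℝ) *
        (η (fun i => v (σ (.inl i))) * ζ (fun i => v (σ (.inr i)))) := by
  rw [AlternatingMap.domCoprod.summand_mk'']
  rcases Int.units_eq_one_or (Equiv.Perm.sign σ) with h | h <;> simp [h]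

/-- The exterior product, evaluated on vectors, as a sum over representatives of the shuffles. -/
theorem wedge_apply (h : k + l = m) (η : V [⋀^Fin k]→ₗ[ℝ] ℝ) (ζ : V [⋀^Fin l]→ₗ[ℝ] ℝ)
    (v : Fin m → V) :
    wedge h η ζ v = ∑ q : Equiv.Perm.ModSumCongr (Fin k) (Fin l),
      (Equiv.Perm.sign q.out : ℝ) * (η (fun i => v (sumIndex h (q.out (.inl i)))) *
        ζ (fun i => v (sumIndex h (q.out (.inr i))))) := by
  have h1 : wedge h η ζ v = LinearMap.mul' ℝ ℝ (η.domCoprod ζ (fun i => v (sumIndex h i))) := rfl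
  rw [h1, AlternatingMap.domCoprod_apply, _root_.sum_apply, map_sum]
  refine Finset.sum_congr rfl fun q _ => ?_
  conv_lhs => rw [← Quotient.out_eq' q]
  exact mul'_summand_mk η ζ q.out _

theorem wedge_add_right (h : k + l = m) (η : V [⋀^Fin k]→ₗ[ℝ] ℝ) (ζ ζ' : V [⋀^Fin l]→ₗ[ℝ] ℝ) :
    wedge h η (ζ + ζ') = wedge h η ζ + wedge h η ζ' := by
  ext v
  simp only [wedge_apply, AlternatingMap.add_apply, ← Finset.sum_add_distrib]
  exact Finset.sum_congr rfl fun q _ => by ring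

theorem wedge_smul_right (h : k + l = m) (η : V [⋀^Fin k]→ₗ[ℝ] ℝ) (c : ℝ)
    (ζ : V [⋀^Fin l]→ₗ[ℝ] ℝ) : wedge h η (c • ζ) = c • wedge h η ζ := by
  ext v
  simp only [wedge_apply, AlternatingMap.smul_apply, smul_eq_mul, Finset.mul_sum]
  exact Finset.sum_congr rfl fun q _ => by ring

theorem wedge_sum_right (h : k + l = m) (η : V [⋀^Fin k]→ₗ[ℝ] ℝ) {ι : Type*} (s : Finset ι)
    (ζ : ι → V [⋀^Fin l]→ₗ[ℝ] ℝ) : wedge h η (∑ i ∈ s, ζ i) = ∑ i ∈ s, wedge h η (ζ i) :=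
  map_sum (⟨⟨wedge h η, wedge_add_right h η⟩, wedge_smul_right h η⟩ :
    (V [⋀^Fin l]→ₗ[ℝ] ℝ) →ₗ[ℝ] V [⋀^Fin m]→ₗ[ℝ] ℝ) ζ s

theorem wedge_compLinearMap (h : k + l = m) (η : W [⋀^Fin k]→ₗ[ℝ] ℝ) (ζ : W [⋀^Fin l]→ₗ[ℝ] ℝ)
    (A : V →ₗ[ℝ] W) :
    wedge h (η.compLinearMap A) (ζ.compLinearMap A) = (wedge h η ζ).compLinearMap A := by
  ext v
  simp only [wedge_apply, AlternatingMap.compLinearMap_apply]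

/-- If all the shuffle terms of `η ∧ ζ` vanish on `w` except the one of the identity, the value on
`w` is the product of the values of `η` and `ζ` on the two halves of `w`. -/
theorem wedge_apply_of_forall (h : k + l = m) (η : V [⋀^Fin k]→ₗ[ℝ] ℝ)
    (ζ : V [⋀^Fin l]→ₗ[ℝ] ℝ) (w : Fin m → V)
    (H : ∀ σ : Equiv.Perm (Fin k ⊕ Fin l), ¬ Set.MapsTo σ (Set.range Sum.inl) (Set.range Sum.inl) →
      η (fun i => w (sumIndex h (σ (.inl i)))) * ζ (fun i => w (sumIndex h (σ (.inr i)))) = 0) :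
    wedge h η ζ w =
      η (fun i => w (sumIndex h (.inl i))) * ζ (fun i => w (sumIndex h (.inr i))) := by
  have h1 : wedge h η ζ w = LinearMap.mul' ℝ ℝ (η.domCoprod ζ (fun i => w (sumIndex h i))) := rfl
  rw [h1, AlternatingMap.domCoprod_apply, _root_.sum_apply, map_sum]
  refine (Finset.sum_eq_single (Quotient.mk'' 1) (fun q _ hq => ?_) fun hq => ?_).trans ?_
  · induction q using Quotient.inductionOn' with | _ σ
    rw [mul'_summand_mk, H σ, mul_zero]
    intro hσ
    apply hq
    obtain ⟨p, hp⟩ := Equiv.Perm.mem_sumCongrHom_range_of_perm_mapsTo_inl hσ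
    refine Quotient.sound' ?_
    rw [QuotientGroup.leftRel_apply, mul_one]
    exact Subgroup.inv_mem _ ⟨p, hp⟩
  · exact absurd (Finset.mem_univ _) hq
  · rw [mul'_summand_mk]
    simp

/-- The contraction `D(u₁, …, u_k, ·)` of a form of degree `m = k + l` with `k` vectors, filling
the first `k` arguments. -/
def contractLeft (h : k + l = m) (D : V [⋀^Fin m]→ₗ[ℝ] ℝ) (u : Fin k → V) :
    V [⋀^Fin l]→ₗ[ℝ] ℝ where
  toFun v := D.domDomCongr (sumIndex h).symm (Sum.elim u v)
  map_update_add' v i x y := by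
    simp only [← Sum.update_elim_inr, AlternatingMap.map_update_add]
  map_update_smul' v i c x := by
    simp only [← Sum.update_elim_inr, AlternatingMap.map_update_smul]
  map_eq_zero_of_eq' v i j hv hij :=
    AlternatingMap.map_eq_zero_of_eq _ _ (i := .inr i) (j := .inr j) (by simpa using hv)
      (by simpa using hij)

/-- The contraction `D(·, u₁, …, u_l)` of a form of degree `m = k + l` with `l` vectors, filling
the last `l` arguments. -/
def contractRight (h : k + l = m) (D : V [⋀^Fin m]→ₗ[ℝ] ℝ) (u : Fin l → V) :
    V [⋀^Fin k]→ₗ[ℝ] ℝ where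
  toFun v := D.domDomCongr (sumIndex h).symm (Sum.elim v u)
  map_update_add' v i x y := by
    simp only [← Sum.update_elim_inl, AlternatingMap.map_update_add]
  map_update_smul' v i c x := by
    simp only [← Sum.update_elim_inl, AlternatingMap.map_update_smul]
  map_eq_zero_of_eq' v i j hv hij :=
    AlternatingMap.map_eq_zero_of_eq _ _ (i := .inl i) (j := .inl j) (by simpa using hv)
      (by simpa using hij)

theorem contractLeft_apply (h : k + l = m) (D : V [⋀^Fin m]→ₗ[ℝ] ℝ) (u : Fin k → V)
    (v : Fin l → V) : contractLeft h D u v = D (Sum.elim u v ∘ (sumIndex h).symm) := rfl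

theorem contractRight_apply (h : k + l = m) (D : V [⋀^Fin m]→ₗ[ℝ] ℝ) (u : Fin l → V)
    (v : Fin k → V) : contractRight h D u v = D (Sum.elim v u ∘ (sumIndex h).symm) := rfl

theorem eq_zero_of_sumElim_eq (h : k + l = m) (D : V [⋀^Fin m]→ₗ[ℝ] ℝ) (u : Fin k → V)
    (v : Fin l → V) {i : Fin k} {j : Fin l} (huv : u i = v j) :
    D (Sum.elim u v ∘ (sumIndex h).symm) = 0 :=
  D.map_eq_zero_of_eq _ (i := sumIndex h (.inl i)) (j := sumIndex h (.inr j)) (by simpa using huv)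
    (by simp)

theorem sumElim_halves {X : Type*} (h : k + l = m) (w : Fin m → X) :
    Sum.elim (fun i => w (sumIndex h (.inl i))) (fun i => w (sumIndex h (.inr i))) ∘
      (sumIndex h).symm = w := by
  funext i
  obtain ⟨j, rfl⟩ := (sumIndex h).surjective i
  rcases j with j | j <;> simp

theorem exists_inr_eq_inl {σ : Equiv.Perm (Fin k ⊕ Fin l)}
    (hσ : ¬ Set.MapsTo σ (Set.range Sum.inl) (Set.range Sum.inl)) :
    ∃ i j, σ (.inr j) = .inl i := by
  by_contra! hc
  rw [Equiv.Perm.perm_mapsTo_inl_iff_mapsTo_inr] at hσ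
  apply hσ
  rintro _ ⟨j, rfl⟩
  rcases hj : σ (.inr j) with a | a
  · exact absurd hj (hc a j)
  · exact ⟨a, rfl⟩

theorem wedge_contractLeft_apply (h : k + l = m) (η : V [⋀^Fin k]→ₗ[ℝ] ℝ)
    (D : V [⋀^Fin m]→ₗ[ℝ] ℝ) (w : Fin m → V) :
    wedge h η (contractLeft h D fun i => w (sumIndex h (.inl i))) w =
      η (fun i => w (sumIndex h (.inl i))) * D w := by
  rw [wedge_apply_of_forall, contractLeft_apply, sumElim_halves]
  intro σ hσ
  -- some vector of the first half of `w` occurs among the remaining arguments of `D`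
  obtain ⟨i, j, hij⟩ := exists_inr_eq_inl hσ
  rw [contractLeft_apply, eq_zero_of_sumElim_eq h D _ _ (i := i) (j := j) (by rw [hij]), mul_zero]

theorem wedge_contractRight_apply (h : k + l = m) (ζ : V [⋀^Fin l]→ₗ[ℝ] ℝ)
    (D : V [⋀^Fin m]→ₗ[ℝ] ℝ) (w : Fin m → V) :
    wedge h (contractRight h D fun i => w (sumIndex h (.inr i))) ζ w =
      ζ (fun i => w (sumIndex h (.inr i))) * D w := by
  rw [wedge_apply_of_forall, contractRight_apply, sumElim_halves, mul_comm]
  intro σ hσ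
  have : ∃ i j, σ (.inl i) = .inr j := by
    by_contra! hc
    apply hσ
    rintro _ ⟨i, rfl⟩
    rcases hj : σ (.inl i) with a | a
    · exact ⟨a, rfl⟩
    · exact absurd hj (hc i a)
  obtain ⟨i, j, hij⟩ := this
  rw [contractRight_apply, eq_zero_of_sumElim_eq h D _ _ (i := i) (j := j) (by rw [hij]), zero_mul]

/-- A top-degree form is determined by its value on one basis. -/
theorem topForm_ext (b : Module.Basis (Fin m) ℝ V) {D D' : V [⋀^Fin m]→ₗ[ℝ] ℝ} (h : D b = D' b) :
    D = D' := by
  rw [D.eq_smul_basis_det b, D'.eq_smul_basis_det b, h]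

/-- `η ∧ D(u, ·) = η(u) D` for a top-degree form `D` and vectors `u` taken from a basis. -/
theorem wedge_contractLeft (h : k + l = m) (b : Module.Basis (Fin m) ℝ V)
    (η : V [⋀^Fin k]→ₗ[ℝ] ℝ) (D : V [⋀^Fin m]→ₗ[ℝ] ℝ) (f : Fin k → Fin m) :
    wedge h η (contractLeft h D (b ∘ f)) = η (b ∘ f) • D := by
  by_cases hf : Function.Injective f
  · obtain ⟨ρ, hρ⟩ := Equiv.Perm.exists_extending_pair (fun i => sumIndex h (.inl i)) f
      (fun i j hij => by simpa using hij) hf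
    have hb : (b ∘ f) = fun i => b.reindex ρ.symm (sumIndex h (.inl i)) := by
      funext i
      simp [hρ]
    refine topForm_ext (b.reindex ρ.symm) ?_
    rw [hb]
    exact wedge_contractLeft_apply h η D _
  · obtain ⟨i, j, hij, hne⟩ := Function.not_injective_iff.mp hf
    have h1 : η (b ∘ f) = 0 := η.map_eq_zero_of_eq _ (by simp [hij]) hne
    have h2 : contractLeft h D (b ∘ f) = 0 := by
      ext v
      exact D.map_eq_zero_of_eq _ (i := sumIndex h (.inl i)) (j := sumIndex h (.inl j))
        (by simp [hij]) (by simpa using hne)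
    rw [h1, h2, zero_smul]
    simpa using wedge_smul_right h η 0 0

/-- `D(·, u) ∧ ζ = ζ(u) D` for a top-degree form `D` and vectors `u` taken from a basis. -/
theorem wedge_contractRight (h : k + l = m) (b : Module.Basis (Fin m) ℝ V)
    (ζ : V [⋀^Fin l]→ₗ[ℝ] ℝ) (D : V [⋀^Fin m]→ₗ[ℝ] ℝ) (f : Fin l → Fin m) :
    wedge h (contractRight h D (b ∘ f)) ζ = ζ (b ∘ f) • D := by
  by_cases hf : Function.Injective f
  · obtain ⟨ρ, hρ⟩ := Equiv.Perm.exists_extending_pair (fun i => sumIndex h (.inr i)) f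
      (fun i j hij => by simpa using hij) hf
    have hb : (b ∘ f) = fun i => b.reindex ρ.symm (sumIndex h (.inr i)) := by
      funext i
      simp [hρ]
    refine topForm_ext (b.reindex ρ.symm) ?_
    rw [hb]
    exact wedge_contractRight_apply h ζ D _
  · obtain ⟨i, j, hij, hne⟩ := Function.not_injective_iff.mp hf
    have h1 : ζ (b ∘ f) = 0 := ζ.map_eq_zero_of_eq _ (by simp [hij]) hne
    have h2 : contractRight h D (b ∘ f) = 0 := by
      ext v
      exact D.map_eq_zero_of_eq _ (i := sumIndex h (.inr i)) (j := sumIndex h (.inr j))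
        (by simp [hij]) (by simpa using hne)
    rw [h1, h2, zero_smul]
    ext v
    simp [wedge_apply]

end Wedge

/-! ### Change of basis and the Hodge dual at a point -/

section Hodge

variable {V W : Type*} [AddCommGroup V] [Module ℝ V] [AddCommGroup W] [Module ℝ W]
  {k l m : ℕ}

/-- The `k`-fold tensor power of a matrix: the matrix of the map induced on `k`-tensors. -/
def tensorPower (k : ℕ) (A : Matrix (Fin m) (Fin m) ℝ) :
    Matrix (Fin k → Fin m) (Fin k → Fin m) ℝ :=
  Matrix.of fun f g => ∏ i, A (f i) (g i)

theorem tensorPower_mul (A B : Matrix (Fin m) (Fin m) ℝ) :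
    tensorPower k (A * B) = tensorPower k A * tensorPower k B := by
  ext f g
  simp only [tensorPower, Matrix.of_apply, Matrix.mul_apply, ← Finset.prod_mul_distrib]
  rw [Finset.prod_univ_sum, Fintype.piFinset_univ]

theorem tensorPower_transpose (A : Matrix (Fin m) (Fin m) ℝ) :
    tensorPower k A.transpose = (tensorPower k A).transpose := rfl

theorem formInner_eq (B : V → V → ℝ) (b : Module.Basis (Fin m) ℝ V) (η ξ : V [⋀^Fin k]→ₗ[ℝ] ℝ) :
    formInner B b η ξ = ((k.factorial : ℝ))⁻¹ * (fun f : Fin k → Fin m => η (b ∘ f)) ⬝ᵥ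
      (tensorPower k (gram B b)⁻¹).mulVec fun f => ξ (b ∘ f) := by
  simp only [formInner, dotProduct, Matrix.mulVec, tensorPower, Matrix.of_apply, Finset.mul_sum]
  refine Finset.sum_congr rfl fun f _ => Finset.sum_congr rfl fun g _ => ?_
  simp only [Function.comp_def]
  ring

theorem components_changeBasis (b c : Module.Basis (Fin m) ℝ V) (η : V [⋀^Fin k]→ₗ[ℝ] ℝ) :
    (fun f : Fin k → Fin m => η (c ∘ f)) =
      (tensorPower k (b.toMatrix c)).transpose.mulVec fun f => η (b ∘ f) := by
  funext f
  have h1 : c ∘ f = fun i => ∑ j, b.toMatrix c j (f i) • b j := by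
    funext i
    simp [b.sum_toMatrix_smul_self]
  rw [h1]
  change η.toMultilinearMap _ = _
  rw [MultilinearMap.map_sum]
  simp only [MultilinearMap.map_smul_univ, smul_eq_mul]
  rfl

theorem gram_changeBasis {B : V → V → ℝ} {β : V →ₗ[ℝ] V →ₗ[ℝ] ℝ} (hB : ∀ v w, B v w = β v w)
    (b c : Module.Basis (Fin m) ℝ V) :
    gram B c = (b.toMatrix c).transpose * gram B b * b.toMatrix c := by
  have h : ∀ d : Module.Basis (Fin m) ℝ V, gram B d = LinearMap.toMatrix₂ d d β := fun d => by
    ext i j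
    simp [gram, hB, LinearMap.toMatrix₂_apply]
  rw [h, h, LinearMap.toMatrix₂_mul_basis_toMatrix]

theorem formInner_changeBasis {B : V → V → ℝ} {β : V →ₗ[ℝ] V →ₗ[ℝ] ℝ}
    (hB : ∀ v w, B v w = β v w) (b c : Module.Basis (Fin m) ℝ V) (η ξ : V [⋀^Fin k]→ₗ[ℝ] ℝ) :
    formInner B c η ξ = formInner B b η ξ := by
  set A := b.toMatrix c with hA
  have hAu : IsUnit A.det := by
    have : Invertible A := b.invertibleToMatrix c
    exact A.isUnit_det_of_invertible
  have hinv : (gram B b)⁻¹ = A * (gram B c)⁻¹ * A.transpose := by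
    rw [gram_changeBasis hB b c, Matrix.mul_inv_rev, Matrix.mul_inv_rev, ← Matrix.mul_assoc,
      ← hA, Matrix.mul_nonsing_inv _ hAu, Matrix.one_mul, Matrix.mul_assoc,
      Matrix.nonsing_inv_mul _ (by rwa [Matrix.det_transpose]), Matrix.mul_one]
  rw [formInner_eq, formInner_eq, components_changeBasis b c η, components_changeBasis b c ξ, hinv,
    tensorPower_mul, tensorPower_mul, tensorPower_transpose, ← Matrix.mulVec_mulVec,
    ← Matrix.mulVec_mulVec, ← hA, Matrix.dotProduct_mulVec _ (tensorPower k A),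
    Matrix.mulVec_transpose _ fun f => η (b ∘ f)]

theorem volumeForm_changeBasis {B : V → V → ℝ} {β : V →ₗ[ℝ] V →ₗ[ℝ] ℝ}
    (hB : ∀ v w, B v w = β v w) (b c : Module.Basis (Fin m) ℝ V) (ν : V [⋀^Fin m]→ₗ[ℝ] ℝ) :
    volumeForm B c ν = volumeForm B b ν := by
  have hAu : (b.toMatrix c).det ≠ 0 := by
    have : Invertible (b.toMatrix c) := b.invertibleToMatrix c
    exact ((b.toMatrix c).isUnit_det_of_invertible).ne_zero
  have h1 : ν c = (b.toMatrix c).det * ν b := by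
    conv_lhs => rw [ν.eq_smul_basis_det b]
    simp [Module.Basis.det_apply, mul_comm]
  have h2 : √|(gram B c).det| = |(b.toMatrix c).det| * √|(gram B b).det| := by
    rw [gram_changeBasis hB b c, Matrix.det_mul, Matrix.det_mul, Matrix.det_transpose,
      mul_comm (b.toMatrix c).det, mul_assoc, abs_mul, abs_mul_self, mul_comm,
      Real.sqrt_mul (mul_self_nonneg _), Real.sqrt_mul_self_eq_abs]
  rw [volumeForm, volumeForm, h1, h2, abs_mul, mul_div_mul_left _ _ (abs_pos.mpr hAu).ne']

theorem volumeForm_apply_basis (B : V → V → ℝ) (b : Module.Basis (Fin m) ℝ V)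
    {ν : V [⋀^Fin m]→ₗ[ℝ] ℝ} :
    volumeForm B b ν b = √|(gram B b).det| * (ν b / |ν b|) := by
  simp only [volumeForm, AlternatingMap.smul_apply, smul_eq_mul]
  ring

/-- The defining property of the Hodge dual `ζ` of `ξ` at a point: `η ∧ ζ = ⟨η, ξ⟩ Vol` for all
`k`-forms `η`, where `Vol` is the metric volume form for the orientation given by `ν`. -/
def IsHodgeAt (h : k + l = m) (B : V → V → ℝ) (b : Module.Basis (Fin m) ℝ V)
    (ν : V [⋀^Fin m]→ₗ[ℝ] ℝ) (ξ : V [⋀^Fin k]→ₗ[ℝ] ℝ) (ζ : V [⋀^Fin l]→ₗ[ℝ] ℝ) : Prop :=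
  ∀ η : V [⋀^Fin k]→ₗ[ℝ] ℝ, wedge h η ζ = formInner B b η ξ • volumeForm B b ν

/-- The Hodge dual at a point exists: it is the contraction of the volume form with the
multivector obtained from `ξ` by raising its indices. -/
theorem exists_isHodgeAt (h : k + l = m) (B : V → V → ℝ) (b : Module.Basis (Fin m) ℝ V)
    (ν : V [⋀^Fin m]→ₗ[ℝ] ℝ) (ξ : V [⋀^Fin k]→ₗ[ℝ] ℝ) : ∃ ζ, IsHodgeAt (l := l) h B b ν ξ ζ := by
  refine ⟨∑ f : Fin k → Fin m, (((k.factorial : ℝ))⁻¹ * ∑ g : Fin k → Fin m,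
    (∏ i, (gram B b)⁻¹ (f i) (g i)) * ξ (b ∘ g)) • contractLeft h (volumeForm B b ν) (b ∘ f),
    fun η => ?_⟩
  rw [wedge_sum_right]
  simp only [wedge_smul_right, wedge_contractLeft, smul_smul, ← Finset.sum_smul]
  congr 1
  simp only [formInner, Finset.mul_sum, Finset.sum_mul, Function.comp_def]
  exact Finset.sum_congr rfl fun f _ => Finset.sum_congr rfl fun g _ => by ring

/-- The components of the Hodge dual, in terms of the inner product. -/
theorem IsHodgeAt.apply_basis {h : k + l = m} {B : V → V → ℝ} {b : Module.Basis (Fin m) ℝ V}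
    {ν : V [⋀^Fin m]→ₗ[ℝ] ℝ} {ξ : V [⋀^Fin k]→ₗ[ℝ] ℝ} {ζ : V [⋀^Fin l]→ₗ[ℝ] ℝ}
    (H : IsHodgeAt h B b ν ξ ζ) (f : Fin l → Fin m) :
    ζ (b ∘ f) = formInner B b (contractRight h b.det (b ∘ f)) ξ *
      (√|(gram B b).det| * (ν b / |ν b|)) := by
  have := congrArg (fun D : V [⋀^Fin m]→ₗ[ℝ] ℝ => D b)
    ((wedge_contractRight h b ζ b.det f).symm.trans (H _))
  simpa [b.det_self, volumeForm_apply_basis] using this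

theorem isHodgeAt_of_apply_basis {h : k + l = m} {B : V → V → ℝ} {b : Module.Basis (Fin m) ℝ V}
    {ν : V [⋀^Fin m]→ₗ[ℝ] ℝ} {ξ : V [⋀^Fin k]→ₗ[ℝ] ℝ} {ζ : V [⋀^Fin l]→ₗ[ℝ] ℝ}
    (H : ∀ f : Fin l → Fin m, ζ (b ∘ f) = formInner B b (contractRight h b.det (b ∘ f)) ξ *
      (√|(gram B b).det| * (ν b / |ν b|))) : IsHodgeAt h B b ν ξ ζ := by
  obtain ⟨ζ', hζ'⟩ := exists_isHodgeAt (l := l) h B b ν ξ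
  have : ζ = ζ' := Module.Basis.ext_alternating b fun f _ =>
    (H f).trans (hζ'.apply_basis f).symm
  rwa [this]

theorem IsHodgeAt.unique {h : k + l = m} {B : V → V → ℝ} {b : Module.Basis (Fin m) ℝ V}
    {ν : V [⋀^Fin m]→ₗ[ℝ] ℝ} {ξ : V [⋀^Fin k]→ₗ[ℝ] ℝ} {ζ ζ' : V [⋀^Fin l]→ₗ[ℝ] ℝ}
    (H : IsHodgeAt h B b ν ξ ζ) (H' : IsHodgeAt h B b ν ξ ζ') : ζ = ζ' :=
  Module.Basis.ext_alternating b fun f _ => (H.apply_basis f).trans (H'.apply_basis f).symm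

theorem IsHodgeAt.smul {h : k + l = m} {B : V → V → ℝ} {b : Module.Basis (Fin m) ℝ V}
    {ν : V [⋀^Fin m]→ₗ[ℝ] ℝ} {ξ : V [⋀^Fin k]→ₗ[ℝ] ℝ} {ζ : V [⋀^Fin l]→ₗ[ℝ] ℝ}
    (H : IsHodgeAt h B b ν ξ ζ) (c : ℝ) : IsHodgeAt h B b ν (c • ξ) (c • ζ) := by
  intro η
  rw [wedge_smul_right, H η, smul_smul]
  congr 1
  simp only [formInner, Finset.mul_sum, AlternatingMap.smul_apply, smul_eq_mul]
  exact Finset.sum_congr rfl fun f _ => Finset.sum_congr rfl fun g _ => by ring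

/-- Hodge duality is natural under linear isomorphisms. -/
theorem IsHodgeAt.pullback {h : k + l = m} {B : W → W → ℝ} {β : W →ₗ[ℝ] W →ₗ[ℝ] ℝ}
    (hB : ∀ v w, B v w = β v w) {c : Module.Basis (Fin m) ℝ W}
    {ν : W [⋀^Fin m]→ₗ[ℝ] ℝ} {ξ : W [⋀^Fin k]→ₗ[ℝ] ℝ} {ζ : W [⋀^Fin l]→ₗ[ℝ] ℝ}
    (H : IsHodgeAt h B c ν ξ ζ) (b : Module.Basis (Fin m) ℝ V) (A : V ≃ₗ[ℝ] W) :
    IsHodgeAt h (fun v w => B (A v) (A w)) b (ν.compLinearMap A.toLinearMap)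
      (ξ.compLinearMap A.toLinearMap) (ζ.compLinearMap A.toLinearMap) := by
  intro η
  obtain ⟨η, rfl⟩ : ∃ η' : W [⋀^Fin k]→ₗ[ℝ] ℝ, η = η'.compLinearMap A.toLinearMap :=
    ⟨η.compLinearMap A.symm.toLinearMap, by ext v; simp⟩
  have h1 : formInner (fun v w => B (A v) (A w)) b (η.compLinearMap A.toLinearMap)
      (ξ.compLinearMap A.toLinearMap) = formInner B (b.map A) η ξ := by
    have : gram (fun v w => B (A v) (A w)) b = gram B (b.map A) := by
      ext i j; simp [gram]
    simp [formInner, this]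
  have h2 : volumeForm (fun v w => B (A v) (A w)) b (ν.compLinearMap A.toLinearMap) =
      (volumeForm B (b.map A) ν).compLinearMap A.toLinearMap := by
    have h3 : gram (fun v w => B (A v) (A w)) b = gram B (b.map A) := by
      ext i j; simp [gram]
    have h4 : (b.map A : Fin m → W) = fun i => A (b i) := by funext i; simp
    ext v
    simp [volumeForm, h3, h4]
    
  rw [wedge_compLinearMap, H η, h1, h2, formInner_changeBasis hB c (b.map A),
    volumeForm_changeBasis hB c (b.map A)]
  rfl

end Hodge

/-! ### Components of tensors and smooth dependence of the inner product -/

section Components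

variable {m k : ℕ}

variable (m) in
/-- The standard basis of `EuclideanSpace ℝ (Fin m)`. -/
abbrev eBasis : Module.Basis (Fin m) ℝ (EuclideanSpace ℝ (Fin m)) :=
  (EuclideanSpace.basisFun (Fin m) ℝ).toBasis

theorem multilinear_expand
    (T : MultilinearMap ℝ (fun _ : Fin k => EuclideanSpace ℝ (Fin m)) ℝ)
    (v : Fin k → EuclideanSpace ℝ (Fin m)) :
    T v = ∑ f : Fin k → Fin m, (∏ i, v i (f i)) * T (eBasis m ∘ f) := by
  have h : v = fun i => ∑ j, v i j • eBasis m j := by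
    funext i
    conv_lhs => rw [← (eBasis m).sum_repr (v i)]
    simp
  conv_lhs => rw [h]
  rw [MultilinearMap.map_sum]
  simp only [MultilinearMap.map_smul_univ, smul_eq_mul]
  rfl

theorem multilinear_continuous
    (T : MultilinearMap ℝ (fun _ : Fin k => EuclideanSpace ℝ (Fin m)) ℝ) : Continuous T := by
  have h : (T : _ → ℝ) = fun v => ∑ f : Fin k → Fin m, (∏ i, v i (f i)) * T (eBasis m ∘ f) :=
    funext fun v => multilinear_expand T v
  rw [h]
  fun_prop

/-- The elementary tensor `x ↦ ∏ i, (x i) (f i)`. -/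
def elemTensor (f : Fin k → Fin m) :
    ContinuousMultilinearMap ℝ (fun _ : Fin k => EuclideanSpace ℝ (Fin m)) ℝ :=
  (ContinuousMultilinearMap.mkPiAlgebra ℝ (Fin k) ℝ).compContinuousLinearMap
    fun i => EuclideanSpace.proj (f i)

theorem tensor_expand
    (T : ContinuousMultilinearMap ℝ (fun _ : Fin k => EuclideanSpace ℝ (Fin m)) ℝ) :
    T = ∑ f : Fin k → Fin m, T (eBasis m ∘ f) • elemTensor f := by
  ext v
  refine (multilinear_expand T.toMultilinearMap v).trans ?_
  simp [elemTensor, mul_comm]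

/-- A family of tensors is smooth as soon as its components are. -/
theorem contDiffOn_of_components {F : Type*} [NormedAddCommGroup F] [NormedSpace ℝ F]
    {T : F → ContinuousMultilinearMap ℝ (fun _ : Fin k => EuclideanSpace ℝ (Fin m)) ℝ} {s : Set F}
    (h : ∀ f : Fin k → Fin m, ContDiffOn ℝ ∞ (fun y => T y (eBasis m ∘ f)) s) :
    ContDiffOn ℝ ∞ T s := by
  have : T = fun y => ∑ f : Fin k → Fin m, T y (eBasis m ∘ f) • elemTensor f :=
    funext fun y => tensor_expand (T y)
  rw [this]
  exact ContDiffOn.sum fun f _ => (h f).smul contDiffOn_const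

theorem contDiffOn_tensor_apply {F : Type*} [NormedAddCommGroup F] [NormedSpace ℝ F]
    {T : F → ContinuousMultilinearMap ℝ (fun _ : Fin k => EuclideanSpace ℝ (Fin m)) ℝ} {s : Set F}
    (h : ContDiffOn ℝ ∞ T s) (v : Fin k → EuclideanSpace ℝ (Fin m)) :
    ContDiffOn ℝ ∞ (fun y => T y v) s :=
  (ContinuousMultilinearMap.apply ℝ (fun _ : Fin k => EuclideanSpace ℝ (Fin m)) ℝ v).contDiff
    |>.comp_contDiffOn h

/-- The Lie derivative is the derivative of `T(c t)(W₁ t, …, W_k t)` for every curve `c` with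
velocity `X` and all vectors `W i` along it that move, to first order, by the differential of the
flow of `X`. -/
theorem hasDerivAt_coordLieDeriv {X : EuclideanSpace ℝ (Fin m) → EuclideanSpace ℝ (Fin m)}
    {T : EuclideanSpace ℝ (Fin m) →
      ContinuousMultilinearMap ℝ (fun _ : Fin k => EuclideanSpace ℝ (Fin m)) ℝ}
    {y : EuclideanSpace ℝ (Fin m)} (hT : DifferentiableAt ℝ T y)
    {w : Fin k → EuclideanSpace ℝ (Fin m)} {c : ℝ → EuclideanSpace ℝ (Fin m)}
    {W : Fin k → ℝ → EuclideanSpace ℝ (Fin m)} (hc : HasDerivAt c (X y) 0) (hc0 : c 0 = y)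
    (hW : ∀ i, HasDerivAt (W i) (fderiv ℝ X y (w i)) 0) (hW0 : ∀ i, W i 0 = w i) :
    HasDerivAt (fun t : ℝ => T (c t) fun i => W i t) (coordLieDeriv X T y w) 0 := by
  subst hc0
  obtain rfl : (fun i => W i 0) = w := funext hW0
  have h1 : HasFDerivAt (fun t : ℝ => T (c t)) _ 0 :=
    HasFDerivAt.comp (0 : ℝ) (g := T) (f := c) hT.hasFDerivAt hc.hasFDerivAt
  refine (h1.continuousMultilinearMap_apply fun i => (hW i).hasFDerivAt).hasDerivAt.congr_deriv ?_
  rw [coordLieDeriv_apply]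
  simp [ContinuousMultilinearMap.toContinuousLinearMap]

theorem contDiff_det : ContDiff ℝ ∞ fun M : Fin m → Fin m → ℝ => (Matrix.of M).det := by
  simp only [Matrix.det_apply, Matrix.of_apply]
  fun_prop

theorem contDiffAt_inv_apply {M : Fin m → Fin m → ℝ} (hM : (Matrix.of M).det ≠ 0) (i j : Fin m) :
    ContDiffAt ℝ ∞ (fun M : Fin m → Fin m → ℝ => (Matrix.of M)⁻¹ i j) M := by
  have h : (fun M : Fin m → Fin m → ℝ => (Matrix.of M)⁻¹ i j) = fun M =>
      ((Matrix.of M).det)⁻¹ * (Matrix.of (Function.update M j (Pi.single i 1))).det := by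
    funext M
    rw [Matrix.inv_def, Matrix.smul_apply, Matrix.adjugate_apply, Ring.inverse_eq_inv', smul_eq_mul]
    rfl
  rw [h]
  refine (contDiff_det.contDiffAt.inv hM).mul (contDiff_det.contDiffAt.comp M ?_)
  refine contDiffAt_pi.mpr fun a => ?_
  by_cases ha : a = j
  · subst ha
    simpa using contDiffAt_const
  · simpa [Function.update_of_ne ha] using (contDiff_apply ℝ (Fin m → ℝ) a).contDiffAt

section Family

variable {V : Type*} [AddCommGroup V] [Module ℝ V] {b : Module.Basis (Fin m) ℝ V}
  {F : Type*} [NormedAddCommGroup F] [NormedSpace ℝ F]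

theorem contDiffAt_formInner {B : F → V → V → ℝ} {ξ : F → V [⋀^Fin k]→ₗ[ℝ] ℝ} {y : F}
    (hB : ContDiffAt ℝ ∞ (fun y i j => gram (B y) b i j) y) (hdet : (gram (B y) b).det ≠ 0)
    (hξ : ∀ f : Fin k → Fin m, ContDiffAt ℝ ∞ (fun y => ξ y (b ∘ f)) y)
    (η : V [⋀^Fin k]→ₗ[ℝ] ℝ) : ContDiffAt ℝ ∞ (fun y => formInner (B y) b η (ξ y)) y := by
  have h : ∀ i j, ContDiffAt ℝ ∞ (fun y => (gram (B y) b)⁻¹ i j) y := fun i j =>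
    ContDiffAt.comp (g := fun M => (Matrix.of M)⁻¹ i j) y (contDiffAt_inv_apply hdet i j) hB
  refine contDiffAt_const.mul (ContDiffAt.sum fun f _ => ContDiffAt.sum fun g _ => ?_)
  exact ((contDiffAt_prod fun i _ => h _ _).mul contDiffAt_const).mul (hξ g)

theorem contDiffAt_sqrt_det {B : F → V → V → ℝ} {y : F}
    (hB : ContDiffAt ℝ ∞ (fun y i j => gram (B y) b i j) y) (hdet : (gram (B y) b).det ≠ 0) :
    ContDiffAt ℝ ∞ (fun y => √|(gram (B y) b).det|) y :=
  ((ContDiffAt.comp (g := fun M : Fin m → Fin m → ℝ => (Matrix.of M).det) y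
    contDiff_det.contDiffAt hB).abs hdet).sqrt (abs_pos.mpr hdet).ne'

/-- A smooth function of a family of matrices whose first derivative vanishes is itself stationary
to first order. -/
theorem hasDerivAt_zero_of_gram {Ψ : (Fin m → Fin m → ℝ) → ℝ} {B : ℝ → V → V → ℝ}
    (hB : ∀ i j, HasDerivAt (fun t => B t (b i) (b j)) 0 0)
    (hΨ : DifferentiableAt ℝ Ψ fun i j => gram (B 0) b i j) :
    HasDerivAt (fun t => Ψ fun i j => gram (B t) b i j) 0 0 := by
  have h : HasDerivAt (fun t i j => gram (B t) b i j) (0 : Fin m → Fin m → ℝ) 0 :=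
    hasDerivAt_pi.mpr fun i => hasDerivAt_pi.mpr fun j => hB i j
  exact (HasFDerivAt.comp_hasDerivAt (0 : ℝ) (l := Ψ) hΨ.hasFDerivAt h).congr_deriv (map_zero _)

theorem hasDerivAt_formInner {B : ℝ → V → V → ℝ} {ξ : ℝ → V [⋀^Fin k]→ₗ[ℝ] ℝ}
    {ξ' : V [⋀^Fin k]→ₗ[ℝ] ℝ} (hB : ∀ i j, HasDerivAt (fun t => B t (b i) (b j)) 0 0)
    (hdet : (gram (B 0) b).det ≠ 0)
    (hξ : ∀ f : Fin k → Fin m, HasDerivAt (fun t => ξ t (b ∘ f)) (ξ' (b ∘ f)) 0)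
    (η : V [⋀^Fin k]→ₗ[ℝ] ℝ) :
    HasDerivAt (fun t => formInner (B t) b η (ξ t)) (formInner (B 0) b η ξ') 0 := by
  refine HasDerivAt.const_mul _ (HasDerivAt.fun_sum fun f _ => HasDerivAt.fun_sum fun g _ => ?_)
  have h : HasDerivAt (fun t => ∏ i, (gram (B t) b)⁻¹ (f i) (g i)) 0 0 := by
    refine hasDerivAt_zero_of_gram (Ψ := fun M => ∏ i, (Matrix.of M)⁻¹ (f i) (g i)) hB ?_
    exact (contDiffAt_prod fun i _ => contDiffAt_inv_apply hdet _ _).differentiableAt (by simp)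
  exact ((h.mul_const _).fun_mul (hξ g)).congr_deriv (by simp [Function.comp_def])

theorem hasDerivAt_sqrt_det {B : ℝ → V → V → ℝ}
    (hB : ∀ i j, HasDerivAt (fun t => B t (b i) (b j)) 0 0) (hdet : (gram (B 0) b).det ≠ 0) :
    HasDerivAt (fun t => √|(gram (B t) b).det|) 0 0 :=
  hasDerivAt_zero_of_gram (Ψ := fun M => √|(Matrix.of M).det|) hB
    (((contDiff_det.contDiffAt.abs hdet).sqrt (abs_pos.mpr hdet).ne').differentiableAt (by simp))

theorem continuousAt_wedge_apply {X : Type*} [TopologicalSpace X] {l n : ℕ} (h : k + l = n)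
    {η : X → V [⋀^Fin k]→ₗ[ℝ] ℝ} {ζ : X → V [⋀^Fin l]→ₗ[ℝ] ℝ} {x : X}
    (hη : ∀ v, ContinuousAt (fun x => η x v) x) (hζ : ∀ v, ContinuousAt (fun x => ζ x v) x)
    (v : Fin n → V) : ContinuousAt (fun x => wedge h (η x) (ζ x) v) x := by
  simp only [wedge_apply]
  exact tendsto_finsetSum _ fun q _ => continuousAt_const.mul ((hη _).mul (hζ _))

end Family

end Components

/-! ### Tensor fields in charts -/

section Charts

variable {m k l : ℕ} {Q : Type*} [TopologicalSpace Q] [ChartedSpace (EuclideanSpace ℝ (Fin m)) Q]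
  [IsManifold (𝓡 m) ∞ Q]

theorem mfderiv_chart_symm_apply {p₀ : Q} {y : EuclideanSpace ℝ (Fin m)}
    (hy : y ∈ (extChartAt (𝓡 m) p₀).target) (v : EuclideanSpace ℝ (Fin m)) :
    mfderiv (𝓡 m) 𝓘(ℝ, EuclideanSpace ℝ (Fin m)) (extChartAt (𝓡 m) p₀)
      ((extChartAt (𝓡 m) p₀).symm y)
      (mfderiv 𝓘(ℝ, EuclideanSpace ℝ (Fin m)) (𝓡 m) (extChartAt (𝓡 m) p₀).symm y v) = v := by
  have : IsManifold (𝓡 m) 1 Q := IsManifold.of_le (n := ∞) (by simp)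
  have h := mfderiv_extChartAt_comp_mfderivWithin_extChartAt_symm hy
  rw [ModelWithCorners.range_eq_univ, mfderivWithin_univ] at h
  exact DFunLike.congr_fun h v

theorem mfderiv_symm_chart_apply {p₀ : Q} {y : EuclideanSpace ℝ (Fin m)}
    (hy : y ∈ (extChartAt (𝓡 m) p₀).target)
    (v : TangentSpace (𝓡 m) ((extChartAt (𝓡 m) p₀).symm y)) :
    mfderiv 𝓘(ℝ, EuclideanSpace ℝ (Fin m)) (𝓡 m) (extChartAt (𝓡 m) p₀).symm y
      (mfderiv (𝓡 m) 𝓘(ℝ, EuclideanSpace ℝ (Fin m)) (extChartAt (𝓡 m) p₀)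
        ((extChartAt (𝓡 m) p₀).symm y) v) = v := by
  have : IsManifold (𝓡 m) 1 Q := IsManifold.of_le (n := ∞) (by simp)
  have h := mfderivWithin_extChartAt_symm_comp_mfderiv_extChartAt hy
  rw [ModelWithCorners.range_eq_univ, mfderivWithin_univ] at h
  exact DFunLike.congr_fun h v

/-- The differential of the inverse of a chart, as a linear isomorphism. -/
def chartEquiv {p₀ : Q} {y : EuclideanSpace ℝ (Fin m)} (hy : y ∈ (extChartAt (𝓡 m) p₀).target) :
    EuclideanSpace ℝ (Fin m) ≃ₗ[ℝ] TangentSpace (𝓡 m) ((extChartAt (𝓡 m) p₀).symm y) :=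
  LinearEquiv.ofLinearMap
    (mfderiv 𝓘(ℝ, EuclideanSpace ℝ (Fin m)) (𝓡 m) (extChartAt (𝓡 m) p₀).symm y).toLinearMap
    (mfderiv (𝓡 m) 𝓘(ℝ, EuclideanSpace ℝ (Fin m)) (extChartAt (𝓡 m) p₀)
      ((extChartAt (𝓡 m) p₀).symm y)).toLinearMap
    (LinearMap.ext fun v => mfderiv_symm_chart_apply hy v)
    (LinearMap.ext fun v => mfderiv_chart_symm_apply hy v)

theorem coordTensor_chart_apply (T : TensorField m Q k) {p₀ q : Q}
    (hq : q ∈ (extChartAt (𝓡 m) p₀).source) (u : Fin k → TangentSpace (𝓡 m) q) :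
    coordTensor T p₀ (extChartAt (𝓡 m) p₀ q) (fun i =>
      mfderiv (𝓡 m) 𝓘(ℝ, EuclideanSpace ℝ (Fin m)) (extChartAt (𝓡 m) p₀) q (u i)) = T q u := by
  obtain ⟨y, hy, rfl⟩ : ∃ y ∈ (extChartAt (𝓡 m) p₀).target, (extChartAt (𝓡 m) p₀).symm y = q :=
    ⟨_, (extChartAt (𝓡 m) p₀).map_source hq, (extChartAt (𝓡 m) p₀).left_inv hq⟩
  have h : coordTensor T p₀ (extChartAt (𝓡 m) p₀ ((extChartAt (𝓡 m) p₀).symm y)) =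
      coordTensor T p₀ y := by rw [(extChartAt (𝓡 m) p₀).right_inv hy]
  rw [h]
  exact congrArg (T _) (funext fun i => mfderiv_symm_chart_apply hy (u i))

/-- At the base point of a chart, the coordinate expression of a tensor is the tensor itself. -/
theorem coordTensor_self (T : TensorField m Q k) (p : Q) (w : Fin k → TangentSpace (𝓡 m) p) :
    coordTensor T p (extChartAt (𝓡 m) p p) w = T p w := by
  have : IsManifold (𝓡 m) 1 Q := IsManifold.of_le (n := ∞) (by simp)
  refine Eq.trans (congrArg _ (funext fun i => ?_))
    (coordTensor_chart_apply T (mem_extChartAt_source (I := 𝓡 m) p) w)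
  rw [mfderiv_extChartAt_self]
  rfl

theorem lieDeriv_apply (X : VField m Q) (T : TensorField m Q k) (p : Q)
    (w : Fin k → TangentSpace (𝓡 m) p) :
    lieDeriv X T p w =
      coordLieDeriv (coordVField X p) (coordTensor T p) (extChartAt (𝓡 m) p p) w := by
  have : IsManifold (𝓡 m) 1 Q := IsManifold.of_le (n := ∞) (by simp)
  refine congrArg (coordLieDeriv (coordVField X p) (coordTensor T p) (extChartAt (𝓡 m) p p))
    (funext fun i => ?_)
  rw [mfderiv_extChartAt_self]
  rfl

omit [IsManifold (𝓡 m) ∞ Q] in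
theorem TensorField.Smooth.contDiffAt {T : TensorField m Q k} (hT : T.Smooth) {p₀ : Q}
    {y : EuclideanSpace ℝ (Fin m)} (hy : y ∈ (extChartAt (𝓡 m) p₀).target) :
    ContDiffAt ℝ ∞ (coordTensor T p₀) y :=
  (hT p₀).contDiffAt ((isOpen_extChartAt_target p₀).mem_nhds hy)

omit [IsManifold (𝓡 m) ∞ Q] in
theorem TensorField.Smooth.differentiableAt {T : TensorField m Q k} (hT : T.Smooth) (p : Q) :
    DifferentiableAt ℝ (coordTensor T p) (extChartAt (𝓡 m) p p) :=
  (hT.contDiffAt (mem_extChartAt_target p)).differentiableAt (by simp)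

theorem hasDerivAt_line {F : Type*} [NormedAddCommGroup F] [NormedSpace ℝ F] (a b : F) :
    HasDerivAt (fun t : ℝ => a + t • b) b 0 := by
  simpa using ((hasDerivAt_id (0 : ℝ)).smul_const b).const_add a

/-- The Lie derivative at `p`, as the derivative of the coordinate expression along a straight line
in the chart at `p`. -/
theorem TensorField.Smooth.hasDerivAt_lieDeriv {T : TensorField m Q k} (hT : T.Smooth)
    (X : VField m Q) (p : Q) (w : Fin k → EuclideanSpace ℝ (Fin m)) :
    HasDerivAt (fun t : ℝ => coordTensor T p
        (extChartAt (𝓡 m) p p + t • coordVField X p (extChartAt (𝓡 m) p p))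
        fun i => w i + t • fderiv ℝ (coordVField X p) (extChartAt (𝓡 m) p p) (w i))
      (lieDeriv X T p w) 0 :=
  (hasDerivAt_coordLieDeriv (hT.differentiableAt p) (hasDerivAt_line _ _) (by simp)
    (fun _ => hasDerivAt_line _ _) (by simp)).congr_deriv (lieDeriv_apply X T p w).symm

/-- The coordinate expression of a form field, as an alternating map. -/
def coordForm (ξ : FormField m Q k) (p₀ : Q) (y : EuclideanSpace ℝ (Fin m)) :
    EuclideanSpace ℝ (Fin m) [⋀^Fin k]→ₗ[ℝ] ℝ :=
  (ξ ((extChartAt (𝓡 m) p₀).symm y)).toAlternatingMap.compLinearMap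
    (mfderiv 𝓘(ℝ, EuclideanSpace ℝ (Fin m)) (𝓡 m) (extChartAt (𝓡 m) p₀).symm y).toLinearMap

end Charts

/-! ### Invariance of the connection form -/

section Euler

variable {n : ℕ} {P : Type*} [TopologicalSpace P]
  [ChartedSpace (EuclideanSpace ℝ (Fin (n + 1))) P] [IsManifold (𝓡 (n + 1)) ∞ P] [MulAction ℝˣ P]

/-- The one-parameter group `s ↦ exp s` of `ℝˣ`. -/
def expUnit (s : ℝ) : ℝˣ := Units.mk0 (Real.exp s) (Real.exp_ne_zero s)

theorem contMDiff_expUnit : ContMDiff 𝓘(ℝ, ℝ) 𝓘(ℝ, ℝ) ∞ expUnit :=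
  ContMDiff.of_comp_isOpenEmbedding Units.isOpenEmbedding_val Real.contDiff_exp.contMDiff

theorem expUnit_zero : expUnit 0 = 1 := by ext; simp [expUnit]

variable (n) in
/-- The flow of the Euler vector field, in the preferred chart at `p`. -/
def coordFlow (p : P) (a : ℝ × EuclideanSpace ℝ (Fin (n + 1))) : EuclideanSpace ℝ (Fin (n + 1)) :=
  extChartAt (𝓡 (n + 1)) p (expUnit a.1 • (extChartAt (𝓡 (n + 1)) p).symm a.2)

theorem coordFlow_contDiffAt
    (hs : ContMDiff (𝓘(ℝ, ℝ).prod (𝓡 (n + 1))) (𝓡 (n + 1)) ∞ (fun a : ℝˣ × P => a.1 • a.2))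
    {p : P} {s : ℝ} {y : EuclideanSpace ℝ (Fin (n + 1))}
    (hy : y ∈ (extChartAt (𝓡 (n + 1)) p).target)
    (hsy : expUnit s • (extChartAt (𝓡 (n + 1)) p).symm y ∈ (extChartAt (𝓡 (n + 1)) p).source) :
    ContDiffAt ℝ ∞ (coordFlow n p) (s, y) := by
  rw [← contMDiffAt_iff_contDiffAt]
  have h1 : ContMDiffAt 𝓘(ℝ, ℝ × EuclideanSpace ℝ (Fin (n + 1))) (𝓡 (n + 1)) ∞
      (fun a => (extChartAt (𝓡 (n + 1)) p).symm a.2) (s, y) :=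
    ContMDiffAt.comp (s, y) (g := (extChartAt (𝓡 (n + 1)) p).symm)
      ((contMDiffOn_extChartAt_symm p).contMDiffAt ((isOpen_extChartAt_target p).mem_nhds hy))
      contDiff_snd.contMDiff.contMDiffAt
  have h2 : ContMDiffAt 𝓘(ℝ, ℝ × EuclideanSpace ℝ (Fin (n + 1))) 𝓘(ℝ, ℝ) ∞
      (fun a => expUnit a.1) (s, y) :=
    (contMDiff_expUnit.comp contDiff_fst.contMDiff).contMDiffAt
  have h3 := ContMDiffAt.comp (s, y) (g := fun a : ℝˣ × P => a.1 • a.2) hs.contMDiffAt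
    (h2.prodMk h1)
  exact ContMDiffAt.comp (s, y) (contMDiffAt_extChartAt' (by simpa using hsy)) h3

theorem fderiv_coordFlow_snd
    (hs : ContMDiff (𝓘(ℝ, ℝ).prod (𝓡 (n + 1))) (𝓡 (n + 1)) ∞ (fun a : ℝˣ × P => a.1 • a.2))
    {p : P} {s : ℝ} {y : EuclideanSpace ℝ (Fin (n + 1))}
    (hy : y ∈ (extChartAt (𝓡 (n + 1)) p).target)
    (hsy : expUnit s • (extChartAt (𝓡 (n + 1)) p).symm y ∈ (extChartAt (𝓡 (n + 1)) p).source)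
    (v : EuclideanSpace ℝ (Fin (n + 1))) :
    fderiv ℝ (coordFlow n p) (s, y) (0, v) =
      mfderiv (𝓡 (n + 1)) 𝓘(ℝ, EuclideanSpace ℝ (Fin (n + 1))) (extChartAt (𝓡 (n + 1)) p)
        (expUnit s • (extChartAt (𝓡 (n + 1)) p).symm y)
        (mfderiv (𝓡 (n + 1)) (𝓡 (n + 1)) (fun q : P => expUnit s • q)
          ((extChartAt (𝓡 (n + 1)) p).symm y)
          (mfderiv 𝓘(ℝ, EuclideanSpace ℝ (Fin (n + 1))) (𝓡 (n + 1))
            (extChartAt (𝓡 (n + 1)) p).symm y v)) := by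
  have hd := (coordFlow_contDiffAt hs hy hsy).differentiableAt (by simp)
  have h1 : HasFDerivAt (fun y => coordFlow n p (s, y)) _ y :=
    HasFDerivAt.comp y (g := coordFlow n p) (f := fun y => (s, y)) hd.hasFDerivAt
      (hasFDerivAt_prodMk_right s y)
  have hsymm : HasMFDerivAt 𝓘(ℝ, EuclideanSpace ℝ (Fin (n + 1))) (𝓡 (n + 1))
      (extChartAt (𝓡 (n + 1)) p).symm y _ :=
    (((contMDiffOn_extChartAt_symm (n := ∞) p).contMDiffAt
      ((isOpen_extChartAt_target p).mem_nhds hy)).mdifferentiableAt (by simp)).hasMFDerivAt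
  have hact : HasMFDerivAt (𝓡 (n + 1)) (𝓡 (n + 1)) (fun q : P => expUnit s • q)
      ((extChartAt (𝓡 (n + 1)) p).symm y) _ :=
    ((hs.comp (contMDiff_const.prodMk contMDiff_id) :
      ContMDiff (𝓡 (n + 1)) (𝓡 (n + 1)) ∞ fun q : P => expUnit s • q).contMDiffAt.mdifferentiableAt
        (by simp)).hasMFDerivAt
  have hchart : HasMFDerivAt (𝓡 (n + 1)) 𝓘(ℝ, EuclideanSpace ℝ (Fin (n + 1)))
      (extChartAt (𝓡 (n + 1)) p) (expUnit s • (extChartAt (𝓡 (n + 1)) p).symm y) _ :=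
    ((contMDiffAt_extChartAt' (n := ∞) (by simpa using hsy)).mdifferentiableAt
      (by simp)).hasMFDerivAt
  have h2 := HasMFDerivAt.comp y (HasMFDerivAt.comp _ hchart hact) hsymm
  have h3 := h1.unique (hasMFDerivAt_iff_hasFDerivAt.mp h2)
  exact DFunLike.congr_fun h3 v

theorem coordVField_euler
    (hs : ContMDiff (𝓘(ℝ, ℝ).prod (𝓡 (n + 1))) (𝓡 (n + 1)) ∞ (fun a : ℝˣ × P => a.1 • a.2))
    {p : P} {y : EuclideanSpace ℝ (Fin (n + 1))}
    (hy : y ∈ (extChartAt (𝓡 (n + 1)) p).target) :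
    coordVField (euler n P) p y = fderiv ℝ (coordFlow n p) (0, y) (1, 0) := by
  set q := (extChartAt (𝓡 (n + 1)) p).symm y with hq
  have h0 : expUnit 0 • q = q := by rw [expUnit_zero, one_smul]
  have hqs : q ∈ (extChartAt (𝓡 (n + 1)) p).source := (extChartAt (𝓡 (n + 1)) p).map_target hy
  have hd := (coordFlow_contDiffAt (s := 0) hs hy (by rwa [← hq, h0])).differentiableAt (by simp)
  have h1 : HasFDerivAt (fun s => coordFlow n p (s, y)) _ 0 :=
    HasFDerivAt.comp 0 (g := coordFlow n p) (f := fun s => (s, y)) hd.hasFDerivAt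
      (hasFDerivAt_prodMk_left 0 y)
  have hcurve : HasMFDerivAt 𝓘(ℝ, ℝ) (𝓡 (n + 1)) (fun s : ℝ => expUnit s • q) 0 _ :=
    ((hs.comp (contMDiff_expUnit.prodMk contMDiff_const) :
      ContMDiff 𝓘(ℝ, ℝ) (𝓡 (n + 1)) ∞ fun s : ℝ => expUnit s • q).contMDiffAt.mdifferentiableAt
        (by simp)).hasMFDerivAt
  have hchart : HasMFDerivAt (𝓡 (n + 1)) 𝓘(ℝ, EuclideanSpace ℝ (Fin (n + 1)))
      (extChartAt (𝓡 (n + 1)) p) (expUnit 0 • q)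
      (mfderiv (𝓡 (n + 1)) 𝓘(ℝ, EuclideanSpace ℝ (Fin (n + 1))) (extChartAt (𝓡 (n + 1)) p) q) := by
    rw [h0]
    exact ((contMDiffAt_extChartAt' (n := ∞) (by simpa using hqs)).mdifferentiableAt
      (by simp)).hasMFDerivAt
  have h3 := h1.unique (hasMFDerivAt_iff_hasFDerivAt.mp (HasMFDerivAt.comp 0 hchart hcurve))
  exact (DFunLike.congr_fun h3 (1 : ℝ)).symm

/-- Invariance of the connection form gives `L_Δ θ = 0`: in a chart, invariance says that
`θ(F(s, y))(∂_y F(s, y) v)` is constant in `s` for the flow `F` of `Δ`, and the derivative of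
`∂_y F(s, y) v` at `s = 0` is `DΔ(v)` by the symmetry of second derivatives. -/
theorem lieDeriv_euler_connection
    (hs : ContMDiff (𝓘(ℝ, ℝ).prod (𝓡 (n + 1))) (𝓡 (n + 1)) ∞ (fun a : ℝˣ × P => a.1 • a.2))
    {θ : FormField (n + 1) P 1} (hθ : IsConnectionForm θ) :
    lieDeriv (euler n P) θ.toTensor = 0 := by
  funext p
  ext w
  rw [lieDeriv_apply]
  set y := extChartAt (𝓡 (n + 1)) p p
  suffices h : ∀ w : Fin 1 → EuclideanSpace ℝ (Fin (n + 1)),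
      coordLieDeriv (coordVField (euler n P) p) (coordTensor θ.toTensor p) y w = 0 from h w
  clear w
  intro w
  have hy : y ∈ (extChartAt (𝓡 (n + 1)) p).target := mem_extChartAt_target p
  have hqs := (extChartAt (𝓡 (n + 1)) p).map_target hy
  have h0 : expUnit 0 • (extChartAt (𝓡 (n + 1)) p).symm y = (extChartAt (𝓡 (n + 1)) p).symm y := by
    rw [expUnit_zero, one_smul]
  have hsm : ContDiffAt ℝ ∞ (coordFlow n p) (0, y) := coordFlow_contDiffAt hs hy (by rwa [h0])
  set D := fderiv ℝ (coordFlow n p) with hD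
  have hDd : DifferentiableAt ℝ D (0, y) :=
    (hsm.fderiv_right (m := ∞) (by simp)).differentiableAt (by simp)
  have hX : coordVField (euler n P) p =ᶠ[nhds y] fun y => D (0, y) (1, 0) := by
    filter_upwards [(isOpen_extChartAt_target p).mem_nhds hy] with y' hy'
    exact coordVField_euler hs hy'
  -- the differential of the coordinate expression of the Euler field, as a mixed second derivative
  have hXd : ∀ v, fderiv ℝ (coordVField (euler n P) p) y v = fderiv ℝ D (0, y) (0, v) (1, 0) := by
    intro v
    rw [hX.fderiv_eq]
    have h1 : HasFDerivAt (fun y => D (0, y)) _ y :=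
      HasFDerivAt.comp y (g := D) (f := fun y => ((0 : ℝ), y)) hDd.hasFDerivAt
        (hasFDerivAt_prodMk_right 0 y)
    rw [(h1.clm_apply (hasFDerivAt_const ((1 : ℝ), (0 : EuclideanSpace ℝ (Fin (n + 1)))) y)).fderiv]
    simp
  have hsymm : IsSymmSndFDerivAt ℝ (coordFlow n p) (0, y) :=
    hsm.isSymmSndFDerivAt (by simpa using ENat.LEInfty.out)
  have hc : HasDerivAt (fun s => coordFlow n p (s, y)) (coordVField (euler n P) p y) 0 := by
    have h1 : HasFDerivAt (fun s => coordFlow n p (s, y)) _ 0 :=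
      HasFDerivAt.comp 0 (g := coordFlow n p) (f := fun s => (s, y))
        (hsm.differentiableAt (by simp)).hasFDerivAt (hasFDerivAt_prodMk_left 0 y)
    refine h1.hasDerivAt.congr_deriv ?_
    rw [hX.eq_of_nhds]
    simp [hD]
  have hc0 : coordFlow n p (0, y) = y := by
    simp only [coordFlow, h0]
    exact (extChartAt (𝓡 (n + 1)) p).right_inv hy
  have hW : ∀ i, HasDerivAt (fun s => D (s, y) (0, w i))
      (fderiv ℝ (coordVField (euler n P) p) y (w i)) 0 := by
    intro i
    have h1 : HasFDerivAt (fun s => D (s, y)) _ 0 :=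
      HasFDerivAt.comp 0 (g := D) (f := fun s => (s, y)) hDd.hasFDerivAt
        (hasFDerivAt_prodMk_left 0 y)
    refine (h1.clm_apply (hasFDerivAt_const ((0 : ℝ), w i) 0)).hasDerivAt.congr_deriv ?_
    rw [hXd, hsymm.eq]
    simp [hD]
  have hD0 : ∀ v, D (0, y) (0, v) = v := by
    intro v
    have h1 : HasFDerivAt (fun y => coordFlow n p (0, y)) _ y :=
      HasFDerivAt.comp y (g := coordFlow n p) (f := fun y => ((0 : ℝ), y))
        (hsm.differentiableAt (by simp)).hasFDerivAt (hasFDerivAt_prodMk_right 0 y)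
    have h2 : (fun y => coordFlow n p (0, y)) =ᶠ[nhds y] id := by
      filter_upwards [(isOpen_extChartAt_target p).mem_nhds hy] with y' hy'
      simp only [coordFlow, expUnit_zero, one_smul]
      exact (extChartAt (𝓡 (n + 1)) p).right_inv hy'
    have h3 := h1.unique ((hasFDerivAt_id y).congr_of_eventuallyEq h2)
    simpa [hD] using DFunLike.congr_fun h3 v
  have hder := hasDerivAt_coordLieDeriv (hθ.smooth.differentiableAt p) hc hc0 hW fun i => hD0 (w i)
  have hcont : ContinuousAt
      (fun s => expUnit s • (extChartAt (𝓡 (n + 1)) p).symm y) 0 :=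
    (hs.comp (contMDiff_expUnit.prodMk contMDiff_const)).continuous.continuousAt
  have hconst : (fun s => coordTensor θ.toTensor p (coordFlow n p (s, y))
      fun i => D (s, y) (0, w i)) =ᶠ[nhds 0] fun _ => coordTensor θ.toTensor p y w := by
    have hmem := hcont.preimage_mem_nhds
      ((isOpen_extChartAt_source (I := 𝓡 (n + 1)) p).mem_nhds (by rwa [h0]))
    filter_upwards [hmem] with s hs'
    have h1 : (fun i => D (s, y) (0, w i)) = fun i => _ :=
      funext fun i => fderiv_coordFlow_snd hs hy hs' (w i)
    rw [h1]
    refine (coordTensor_chart_apply θ.toTensor hs' _).trans ?_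
    have h2 := hθ.invariant (expUnit s) ((extChartAt (𝓡 (n + 1)) p).symm y)
      (mfderiv 𝓘(ℝ, EuclideanSpace ℝ (Fin (n + 1))) (𝓡 (n + 1))
        (extChartAt (𝓡 (n + 1)) p).symm y (w 0))
    refine Eq.trans (congrArg (θ _) ?_) (h2.trans (congrArg (θ _) ?_)) <;>
    · funext i
      rw [Subsingleton.elim i 0]
      rfl
  exact hder.unique ((hasDerivAt_const (0 : ℝ) _).congr_of_eventuallyEq hconst)

end Euler

/-! ### Geometry of the bundle and the Lorentzian metric -/

section BundleFacts

/-- A covariant tensor of rank two as a bilinear map. -/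
def tensorBilin {V : Type*} [AddCommGroup V] [Module ℝ V] [TopologicalSpace V]
    (T : ContinuousMultilinearMap ℝ (fun _ : Fin 2 => V) ℝ) : V →ₗ[ℝ] V →ₗ[ℝ] ℝ :=
  have h0 : ∀ v w x : V, Function.update ![v, w] 0 x = ![x, w] := fun v w x => by
    funext i; fin_cases i <;> simp
  have h1 : ∀ v w x : V, Function.update ![v, w] 1 x = ![v, x] := fun v w x => by
    funext i; fin_cases i <;> simp
  LinearMap.mk₂ ℝ (fun v w => T ![v, w])
    (fun v v' w => by simpa only [h0] using T.map_update_add ![v, w] 0 v v')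
    (fun c v w => by simpa only [h0] using T.map_update_smul ![v, w] 0 c v)
    (fun v w w' => by simpa only [h1] using T.map_update_add ![v, w] 1 w w')
    (fun c v w => by simpa only [h1] using T.map_update_smul ![v, w] 1 c w)

variable {n : ℕ} {M P : Type*}
  [TopologicalSpace M] [ChartedSpace (EuclideanSpace ℝ (Fin n)) M]
  [TopologicalSpace P] [ChartedSpace (EuclideanSpace ℝ (Fin (n + 1))) P] [MulAction ℝˣ P]
  {π : P → M}

theorem IsPrincipalBundle.contMDiff_proj (hπ : IsPrincipalBundle n π) :
    ContMDiff (𝓡 (n + 1)) (𝓡 n) ∞ π := by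
  intro p
  obtain ⟨e, hx, he, -, -⟩ := hπ.exists_trivialization (π p)
  have hp : p ∈ e.source := e.mem_source.mpr hx
  have h1 : ContMDiffAt (𝓡 (n + 1)) (𝓡 n) ∞ (fun q => (e q).1) p :=
    contMDiffAt_fst.comp p (he.contMDiffAt (e.open_source.mem_nhds hp))
  refine h1.congr_of_eventuallyEq ?_
  filter_upwards [e.open_source.mem_nhds hp] with q hq
  exact (e.coe_fst hq).symm

/-- The differential of the projection has a right inverse, the differential of a local section. -/
theorem IsPrincipalBundle.exists_lift (hπ : IsPrincipalBundle n π) (p : P) :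
    ∃ S : EuclideanSpace ℝ (Fin n) →L[ℝ] TangentSpace (𝓡 (n + 1)) p,
      ∀ v, mfderiv (𝓡 (n + 1)) (𝓡 n) π p (S v) = v := by
  obtain ⟨e, hx, -, he, -⟩ := hπ.exists_trivialization (π p)
  have hp : p ∈ e.source := e.mem_source.mpr hx
  have h0 : e.toOpenPartialHomeomorph.symm (π p, (e p).2) = p := by
    have : (π p, (e p).2) = e p := Prod.ext (e.coe_fst hp).symm rfl
    rw [this]
    exact e.toOpenPartialHomeomorph.left_inv hp
  have hmem : (π p, (e p).2) ∈ e.target := e.mem_target.mpr hx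
  have hs : HasMFDerivAt (𝓡 n) (𝓡 (n + 1))
      (fun x => e.toOpenPartialHomeomorph.symm (x, (e p).2)) (π p) _ :=
    ((ContMDiffAt.comp (π p) (he.contMDiffAt (e.open_target.mem_nhds hmem))
      (contMDiffAt_id.prodMk contMDiffAt_const)).mdifferentiableAt (by simp)).hasMFDerivAt
  have hπ' : HasMFDerivAt (𝓡 (n + 1)) (𝓡 n) π (e.toOpenPartialHomeomorph.symm (π p, (e p).2))
      (mfderiv (𝓡 (n + 1)) (𝓡 n) π p) := by
    rw [h0]
    exact (hπ.contMDiff_proj.contMDiffAt.mdifferentiableAt (by simp)).hasMFDerivAt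
  have hid : HasMFDerivAt (𝓡 n) (𝓡 n) (π ∘ fun x => e.toOpenPartialHomeomorph.symm (x, (e p).2))
      (π p) (ContinuousLinearMap.id ℝ (EuclideanSpace ℝ (Fin n))) := by
    refine (hasMFDerivAt_id (π p)).congr_of_eventuallyEq ?_
    filter_upwards [e.open_baseSet.mem_nhds hx] with x hx'
    exact e.proj_symm_apply' hx'
  exact ⟨_, fun v => DFunLike.congr_fun (hasMFDerivAt_unique (HasMFDerivAt.comp (π p)
    (f := fun x => e.toOpenPartialHomeomorph.symm (x, (e p).2)) hπ' hs) hid) v⟩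

theorem IsPrincipalBundle.mfderiv_proj_euler (hπ : IsPrincipalBundle n π) (p : P) :
    mfderiv (𝓡 (n + 1)) (𝓡 n) π p (euler n P p) = 0 := by
  have hcurve : HasMFDerivAt 𝓘(ℝ, ℝ) (𝓡 (n + 1)) (fun s : ℝ => expUnit s • p) 0 _ :=
    ((hπ.smooth_smul.comp (contMDiff_expUnit.prodMk contMDiff_const) :
      ContMDiff 𝓘(ℝ, ℝ) (𝓡 (n + 1)) ∞ fun s : ℝ => expUnit s • p).contMDiffAt.mdifferentiableAt
        (by simp)).hasMFDerivAt
  have hπ' : HasMFDerivAt (𝓡 (n + 1)) (𝓡 n) π (expUnit 0 • p)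
      (mfderiv (𝓡 (n + 1)) (𝓡 n) π p) := by
    rw [expUnit_zero, one_smul]
    exact (hπ.contMDiff_proj.contMDiffAt.mdifferentiableAt (by simp)).hasMFDerivAt
  have hconst : (π ∘ fun s : ℝ => expUnit s • p) = fun _ => π p :=
    funext fun s => hπ.proj_smul _ _
  have h := HasMFDerivAt.comp (0 : ℝ) (f := fun s : ℝ => expUnit s • p) hπ' hcurve
  rw [hconst] at h
  exact DFunLike.congr_fun (hasMFDerivAt_unique h (hasMFDerivAt_const (π p) (0 : ℝ))) (1 : ℝ)

theorem IsPrincipalBundle.exists_eq_smul_euler (hπ : IsPrincipalBundle n π)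
    {θ : FormField (n + 1) P 1} (hθ : IsConnectionForm θ) {p : P}
    {v : TangentSpace (𝓡 (n + 1)) p} (hv : mfderiv (𝓡 (n + 1)) (𝓡 n) π p v = 0) :
    ∃ c : ℝ, v = c • euler n P p := by
  obtain ⟨S, hS⟩ := hπ.exists_lift p
  let A : EuclideanSpace ℝ (Fin (n + 1)) →ₗ[ℝ] EuclideanSpace ℝ (Fin n) :=
    (mfderiv (𝓡 (n + 1)) (𝓡 n) π p).toLinearMap
  have hA : LinearMap.range A = ⊤ := LinearMap.range_eq_top.mpr fun w => ⟨S w, hS w⟩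
  have hker : Module.finrank ℝ (LinearMap.ker A) = 1 := by
    have := A.finrank_range_add_finrank_ker
    rw [hA, finrank_top, finrank_euclideanSpace_fin, finrank_euclideanSpace_fin] at this
    omega
  have h0 : (⟨euler n P p, hπ.mfderiv_proj_euler p⟩ : LinearMap.ker A) ≠ 0 := by
    intro h
    have h1 : euler n P p = 0 := congrArg Subtype.val h
    have h2 := hθ.euler p
    rw [h1, (θ p).map_coord_zero 0 (by simp)] at h2
    exact zero_ne_one h2
  obtain ⟨c, hc⟩ := (finrank_eq_one_iff_of_nonzero' _ h0).mp hker ⟨v, hv⟩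
  exact ⟨c, (congrArg Subtype.val hc).symm⟩

omit [MulAction ℝˣ P] in
theorem lorentzMetric_apply (g : TensorField (n + 1) P 2) (θ : FormField (n + 1) P 1) (p : P)
    (v w : TangentSpace (𝓡 (n + 1)) p) :
    lorentzMetric g θ p ![v, w] = g p ![v, w] - θ p ![v] * θ p ![w] := by
  have h : ∀ v : TangentSpace (𝓡 (n + 1)) p, (fun _ : Fin 1 => v) = ![v] := fun v => by
    funext i; rw [Subsingleton.elim i 0]; rfl
  change g p ![v, w] - tensorSq θ p ![v, w] = _
  congr 1
  simp only [tensorSq, ContinuousMultilinearMap.compContinuousLinearMap_apply,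
    ContinuousMultilinearMap.mkPiAlgebra_apply, Fin.prod_univ_two]
  exact congrArg₂ (fun a b => θ p a * θ p b) (h v) (h w)

/-- `G = g - θ ⊗ θ` is nondegenerate. -/
theorem lorentzMetric_nondegenerate (hπ : IsPrincipalBundle n π) {g : TensorField (n + 1) P 2}
    (hg : IsCarrollianMetric π g) {θ : FormField (n + 1) P 1} (hθ : IsConnectionForm θ) {p : P}
    {v : TangentSpace (𝓡 (n + 1)) p} (hv : ∀ w, lorentzMetric g θ p ![v, w] = 0) : v = 0 := by
  have hΔ : g p ![v, euler n P p] = 0 := by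
    rw [hg.symm]
    exact (hg.ker p _).mpr (hπ.mfderiv_proj_euler p) v
  have h1 : θ p ![v] = 0 := by
    have := hv (euler n P p)
    rw [lorentzMetric_apply, hΔ, hθ.euler] at this
    linarith
  have h2 : mfderiv (𝓡 (n + 1)) (𝓡 n) π p v = 0 := by
    rw [← hg.ker]
    intro w
    have := hv w
    rw [lorentzMetric_apply, h1] at this
    linarith
  obtain ⟨c, rfl⟩ := hπ.exists_eq_smul_euler hθ h2
  have h3 : θ p ![c • euler n P p] = c * θ p ![euler n P p] := by
    have := (θ p).map_update_smul ![0] 0 c (euler n P p)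
    have hu : ∀ x : TangentSpace (𝓡 (n + 1)) p, Function.update ![0] (0 : Fin 1) x = ![x] :=
      fun x => by funext i; rw [Subsingleton.elim i 0]; simp
    simpa only [hu, smul_eq_mul] using this
  rw [h3, hθ.euler, mul_one] at h1
  rw [h1, zero_smul]

theorem det_gram_lorentzMetric_ne_zero (hπ : IsPrincipalBundle n π)
    {g : TensorField (n + 1) P 2} (hg : IsCarrollianMetric π g) {θ : FormField (n + 1) P 1}
    (hθ : IsConnectionForm θ) (p : P)
    (b : Module.Basis (Fin (n + 1)) ℝ (TangentSpace (𝓡 (n + 1)) p)) :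
    (gram (fun v w => lorentzMetric g θ p ![v, w]) b).det ≠ 0 := by
  have h : gram (fun v w => lorentzMetric g θ p ![v, w]) b =
      LinearMap.toMatrix₂ b b (tensorBilin (lorentzMetric g θ p)) := by
    ext i j
    rw [LinearMap.toMatrix₂_apply]
    rfl
  rw [h, ← LinearMap.separatingLeft_iff_det_ne_zero]
  exact fun v hv => lorentzMetric_nondegenerate hπ hg hθ hv

/-- The form `(-1)^n θ ∧ π^* ζ`, with `ζ` representing the orientation of the base, that gives the
orientation of the total space. -/
def orientForm (π : P → M) (θ : FormField (n + 1) P 1)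
    (o : ∀ x : M, Orientation ℝ (TangentSpace (𝓡 n) x) (Fin n)) (p : P) :
    (TangentSpace (𝓡 (n + 1)) p) [⋀^Fin (n + 1)]→ₗ[ℝ] ℝ :=
  (-1 : ℝ) ^ n • wedge (Nat.add_comm 1 n) (θ p).toAlternatingMap
    ((o (π p)).someVector.compLinearMap (mfderiv (𝓡 (n + 1)) (𝓡 n) π p).toLinearMap)

/-- The orientation form does not vanish: its value on the Euler field followed by lifts of a basis
of the tangent space of the base is nonzero. -/
theorem orientForm_ne_zero (hπ : IsPrincipalBundle n π) {θ : FormField (n + 1) P 1}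
    (hθ : IsConnectionForm θ) (o : ∀ x : M, Orientation ℝ (TangentSpace (𝓡 n) x) (Fin n)) (p : P) :
    orientForm π θ o p ≠ 0 := by
  obtain ⟨S, hS⟩ := hπ.exists_lift p
  let O : EuclideanSpace ℝ (Fin n) [⋀^Fin n]→ₗ[ℝ] ℝ := (o (π p)).someVector
  have hO : O (eBasis n) ≠ 0 :=
    (AlternatingMap.map_basis_ne_zero_iff (eBasis n) O).mpr (o (π p)).someVector_ne_zero
  let w : Fin (n + 1) → TangentSpace (𝓡 (n + 1)) p :=
    Sum.elim (fun _ : Fin 1 => euler n P p) (fun i => S (eBasis n i)) ∘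
      (sumIndex (Nat.add_comm 1 n)).symm
  intro h
  have h1 : (-1 : ℝ) ^ n * wedge (Nat.add_comm 1 n) (θ p).toAlternatingMap
      ((o (π p)).someVector.compLinearMap (mfderiv (𝓡 (n + 1)) (𝓡 n) π p).toLinearMap) w = 0 :=
    DFunLike.congr_fun h w
  rw [mul_eq_zero_iff_left (by simp), wedge_apply_of_forall] at h1
  · rcases mul_eq_zero.mp h1 with h2 | h2
    · have h3 : θ p ![euler n P p] = 0 := by
        refine Eq.trans (congrArg (θ p) ?_) h2
        funext i
        rw [Subsingleton.elim i 0]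
        simp [w]
      exact one_ne_zero ((hθ.euler p).symm.trans h3)
    · apply hO
      refine Eq.trans (congrArg O (funext fun i => ?_)) h2
      simp [w, hS]
  · intro σ hσ
    obtain ⟨i, j, hij⟩ := exists_inr_eq_inl hσ
    refine mul_eq_zero_of_right _ (AlternatingMap.map_coord_zero
      (o (π p)).someVector j ?_)
    change mfderiv (𝓡 (n + 1)) (𝓡 n) π p (w (sumIndex _ (σ (.inr j)))) = 0
    rw [hij]
    simpa [w] using hπ.mfderiv_proj_euler p

theorem div_abs_eq_of_pos {a b r s : ℝ} (hr : 0 < r) (hs : 0 < s) (h : r * a = s * b) :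
    a / |a| = b / |b| := by
  have h2 : r * |a| = s * |b| := by
    have := congrArg abs h
    rwa [abs_mul, abs_mul, abs_of_pos hr, abs_of_pos hs] at this
  rw [← mul_div_mul_left a |a| hr.ne', ← mul_div_mul_left b |b| hs.ne', h, h2]

end BundleFacts

/-! ### The orientation in charts -/

section Orientation

/-- An alternating map on a tangent space, as a continuous alternating map. -/
def toForm {m k : ℕ} {Q : Type*} [TopologicalSpace Q] [ChartedSpace (EuclideanSpace ℝ (Fin m)) Q]
    {p : Q} (ζ : (TangentSpace (𝓡 m) p) [⋀^Fin k]→ₗ[ℝ] ℝ) :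
    (TangentSpace (𝓡 m) p) [⋀^Fin k]→L[ℝ] ℝ :=
  { ζ with cont := multilinear_continuous (m := m) ζ.toMultilinearMap }

variable {n : ℕ} {M P : Type*}
  [TopologicalSpace M] [ChartedSpace (EuclideanSpace ℝ (Fin n)) M] [IsManifold (𝓡 n) ∞ M]
  [TopologicalSpace P] [ChartedSpace (EuclideanSpace ℝ (Fin (n + 1))) P]
  [IsManifold (𝓡 (n + 1)) ∞ P] [MulAction ℝˣ P] {π : P → M}

/-- The field of orientation forms `orientForm`. -/
def orientField (π : P → M) (θ : FormField (n + 1) P 1)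
    (o : ∀ x : M, Orientation ℝ (TangentSpace (𝓡 n) x) (Fin n)) : FormField (n + 1) P (n + 1) :=
  fun p => toForm (orientForm π θ o p)

omit [IsManifold (𝓡 n) ∞ M] [IsManifold (𝓡 (n + 1)) ∞ P] [MulAction ℝˣ P] in
theorem coordForm_orientField_apply (θ : FormField (n + 1) P 1)
    (o : ∀ x : M, Orientation ℝ (TangentSpace (𝓡 n) x) (Fin n)) (p₀ : P)
    (y : EuclideanSpace ℝ (Fin (n + 1))) (v : Fin (n + 1) → EuclideanSpace ℝ (Fin (n + 1))) :
    coordForm (orientField π θ o) p₀ y v = (-1 : ℝ) ^ n *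
      wedge (Nat.add_comm 1 n) (coordForm θ p₀ y)
        (((o (π ((extChartAt (𝓡 (n + 1)) p₀).symm y))).someVector.compLinearMap
          (mfderiv (𝓡 (n + 1)) (𝓡 n) π
            ((extChartAt (𝓡 (n + 1)) p₀).symm y)).toLinearMap).compLinearMap
          (mfderiv 𝓘(ℝ, EuclideanSpace ℝ (Fin (n + 1))) (𝓡 (n + 1))
            (extChartAt (𝓡 (n + 1)) p₀).symm y).toLinearMap) v := by
  let A : EuclideanSpace ℝ (Fin (n + 1)) →ₗ[ℝ]
      TangentSpace (𝓡 (n + 1)) ((extChartAt (𝓡 (n + 1)) p₀).symm y) :=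
    (mfderiv 𝓘(ℝ, EuclideanSpace ℝ (Fin (n + 1))) (𝓡 (n + 1))
      (extChartAt (𝓡 (n + 1)) p₀).symm y).toLinearMap
  exact congrArg (fun z => (-1 : ℝ) ^ n * z) (DFunLike.congr_fun
    (wedge_compLinearMap (Nat.add_comm 1 n) _ _ A) v).symm

omit [IsManifold (𝓡 n) ∞ M] in
theorem coordForm_orientField_ne_zero (hπ : IsPrincipalBundle n π) {θ : FormField (n + 1) P 1}
    (hθ : IsConnectionForm θ) (o : ∀ x : M, Orientation ℝ (TangentSpace (𝓡 n) x) (Fin n)) {p₀ : P}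
    {y : EuclideanSpace ℝ (Fin (n + 1))} (hy : y ∈ (extChartAt (𝓡 (n + 1)) p₀).target) :
    coordForm (orientField π θ o) p₀ y (eBasis (n + 1)) ≠ 0 := by
  have h := (AlternatingMap.map_basis_ne_zero_iff ((eBasis (n + 1)).map (chartEquiv hy)) _).mpr
    (orientForm_ne_zero hπ hθ o ((extChartAt (𝓡 (n + 1)) p₀).symm y))
  intro h0
  apply h
  refine Eq.trans (congrArg _ (funext fun i => ?_)) h0
  rw [Module.Basis.map_apply]
  rfl

theorem eventually_sign_eq {X : Type*} [TopologicalSpace X] {f : X → ℝ} {x : X}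
    (hf : ContinuousAt f x) (hx : f x ≠ 0) : ∀ᶠ y in nhds x, f y / |f y| = f x / |f x| := by
  have h : ∀ᶠ y in nhds x, 0 < f y * f x :=
    (hf.mul continuousAt_const).eventually (lt_mem_nhds (mul_self_pos.mpr hx))
  filter_upwards [h] with y hy
  rcases lt_or_gt_of_ne hx with h' | h'
  · have : f y < 0 := by
      by_contra! hc
      exact absurd hy (not_lt.mpr (mul_nonpos_of_nonneg_of_nonpos hc h'.le))
    rw [abs_of_neg this, abs_of_neg h', div_neg_self this.ne, div_neg_self h'.ne]
  · have : 0 < f y := pos_of_mul_pos_left hy h'.le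
    rw [abs_of_pos this, abs_of_pos h', div_self this.ne', div_self h'.ne']

theorem sign_wedge_of_sameRay {V W : Type*} [AddCommGroup V] [Module ℝ V] [AddCommGroup W]
    [Module ℝ W] {k l m : ℕ} {h : k + l = m} (c : ℝ) (η : V [⋀^Fin k]→ₗ[ℝ] ℝ) (A : V →ₗ[ℝ] W)
    {ζ ζ' : W [⋀^Fin l]→ₗ[ℝ] ℝ} {v : Fin m → V} (hζ : ζ ≠ 0) (hray : SameRay ℝ ζ ζ')
    (hne : c * wedge h η (ζ'.compLinearMap A) v ≠ 0) :
    c * wedge h η (ζ.compLinearMap A) v / |c * wedge h η (ζ.compLinearMap A) v| =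
      c * wedge h η (ζ'.compLinearMap A) v / |c * wedge h η (ζ'.compLinearMap A) v| := by
  have hlin : ∀ (r : ℝ) (ζ : W [⋀^Fin l]→ₗ[ℝ] ℝ), c * wedge h η ((r • ζ).compLinearMap A) v =
      r * (c * wedge h η (ζ.compLinearMap A) v) := by
    intro r ζ
    have : (r • ζ).compLinearMap A = r • ζ.compLinearMap A := rfl
    rw [this, wedge_smul_right, AlternatingMap.smul_apply, smul_eq_mul]
    ring
  rcases hray with h0 | h0 | ⟨r₁, r₂, hr₁, hr₂, hr⟩
  · exact absurd h0 hζ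
  · refine absurd ?_ hne
    rw [h0, ← zero_smul ℝ (0 : W [⋀^Fin l]→ₗ[ℝ] ℝ), hlin, zero_mul]
  · refine div_abs_eq_of_pos hr₁ hr₂ ?_
    rw [← hlin, ← hlin, hr]

/-- The sign of the orientation form in the coordinate basis is locally constant.  Near `y₀` the
orientation of `M` is represented by a form constant in the chart at the projected point, and
with this representative the orientation form is continuous. -/
theorem eventually_orientSign (hπ : IsPrincipalBundle n π) {θ : FormField (n + 1) P 1}
    (hθ : IsConnectionForm θ) {o : ∀ x : M, Orientation ℝ (TangentSpace (𝓡 n) x) (Fin n)}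
    (ho : IsManifoldOrientation o) {p₀ : P} {y₀ : EuclideanSpace ℝ (Fin (n + 1))}
    (hy₀ : y₀ ∈ (extChartAt (𝓡 (n + 1)) p₀).target) :
    ∀ᶠ y in nhds y₀, coordForm (orientField π θ o) p₀ y (eBasis (n + 1)) /
        |coordForm (orientField π θ o) p₀ y (eBasis (n + 1))| =
      coordForm (orientField π θ o) p₀ y₀ (eBasis (n + 1)) /
        |coordForm (orientField π θ o) p₀ y₀ (eBasis (n + 1))| := by
  have : IsManifold (𝓡 n) 1 M := IsManifold.of_le (n := ∞) (by simp)
  set φ := extChartAt (𝓡 (n + 1)) p₀ with hφ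
  set x₀ := π (φ.symm y₀) with hx₀
  let O : EuclideanSpace ℝ (Fin n) [⋀^Fin n]→ₗ[ℝ] ℝ := (o x₀).someVector
  let F : EuclideanSpace ℝ (Fin (n + 1)) → EuclideanSpace ℝ (Fin n) :=
    fun y => extChartAt (𝓡 n) x₀ (π (φ.symm y))
  have hsymm : ∀ y ∈ φ.target, ContMDiffAt 𝓘(ℝ, EuclideanSpace ℝ (Fin (n + 1))) (𝓡 (n + 1)) ∞
      φ.symm y := fun y hy =>
    (contMDiffOn_extChartAt_symm p₀).contMDiffAt ((isOpen_extChartAt_target p₀).mem_nhds hy)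
  have hFs : ∀ y ∈ φ.target, π (φ.symm y) ∈ (extChartAt (𝓡 n) x₀).source →
      ContDiffAt ℝ ∞ F y := by
    intro y hy hy'
    rw [← contMDiffAt_iff_contDiffAt]
    exact ContMDiffAt.comp y (contMDiffAt_extChartAt' (by simpa using hy'))
      (ContMDiffAt.comp y hπ.contMDiff_proj.contMDiffAt (hsymm y hy))
  have hFd : ∀ y ∈ φ.target, π (φ.symm y) ∈ (extChartAt (𝓡 n) x₀).source →
      ∀ v : EuclideanSpace ℝ (Fin (n + 1)), fderiv ℝ F y v =
        mfderiv (𝓡 n) 𝓘(ℝ, EuclideanSpace ℝ (Fin n)) (extChartAt (𝓡 n) x₀) (π (φ.symm y))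
          (mfderiv (𝓡 (n + 1)) (𝓡 n) π (φ.symm y)
            (mfderiv 𝓘(ℝ, EuclideanSpace ℝ (Fin (n + 1))) (𝓡 (n + 1)) φ.symm y v)) := by
    intro y hy hy' v
    have h1 := ((hsymm y hy).mdifferentiableAt (by simp)).hasMFDerivAt
    have h2 := (hπ.contMDiff_proj.contMDiffAt.mdifferentiableAt (x := φ.symm y)
      (by simp)).hasMFDerivAt
    have h3 := ((contMDiffAt_extChartAt' (I := 𝓡 n) (n := ∞) (x := x₀) (x' := π (φ.symm y))
      (by simpa using hy')).mdifferentiableAt (by simp)).hasMFDerivAt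
    have h4 := ((hFs y hy hy').differentiableAt (by simp)).hasFDerivAt.unique
      (hasMFDerivAt_iff_hasFDerivAt.mp (HasMFDerivAt.comp y (f := fun y => π (φ.symm y)) h3
        (HasMFDerivAt.comp y (f := φ.symm) h2 h1)))
    exact DFunLike.congr_fun h4 v
  -- the orientation form, computed with the constant representative `O`
  let s' : EuclideanSpace ℝ (Fin (n + 1)) → ℝ := fun y => (-1 : ℝ) ^ n *
    wedge (Nat.add_comm 1 n) (coordForm θ p₀ y) (O.compLinearMap (fderiv ℝ F y).toLinearMap)
      (eBasis (n + 1))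
  have hmem₀ : π (φ.symm y₀) ∈ (extChartAt (𝓡 n) x₀).source := mem_extChartAt_source x₀
  have hcont : ContinuousAt s' y₀ := by
    refine continuousAt_const.mul (continuousAt_wedge_apply _ (fun v => ?_) (fun v => ?_) _)
    · have := (hθ.smooth.contDiffAt hy₀).continuousAt
      exact ((ContinuousMultilinearMap.apply ℝ (fun _ : Fin 1 => EuclideanSpace ℝ (Fin (n + 1))) ℝ
        v).continuous.continuousAt).comp this
    · have hd : ContinuousAt (fderiv ℝ F) y₀ :=
        ((hFs y₀ hy₀ hmem₀).fderiv_right (m := ∞) (by simp)).continuousAt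
      exact (multilinear_continuous O.toMultilinearMap).continuousAt.comp
        (f := fun y i => fderiv ℝ F y (v i))
        (tendsto_pi_nhds.mpr fun i => hd.clm_apply continuousAt_const)
  -- the chart at `x₀` has identity differential at `x₀`, so `s'` agrees with the form at `y₀`
  have hs₀ : s' y₀ = coordForm (orientField π θ o) p₀ y₀ (eBasis (n + 1)) := by
    rw [coordForm_orientField_apply]
    refine congrArg (fun ζ => (-1 : ℝ) ^ n * wedge (Nat.add_comm 1 n) (coordForm θ p₀ y₀) ζ
      (eBasis (n + 1))) (AlternatingMap.ext fun v => congrArg O (funext fun i => ?_))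
    refine (hFd y₀ hy₀ hmem₀ (v i)).trans ?_
    rw [mfderiv_extChartAt_self]
    rfl
  have hne : s' y₀ ≠ 0 := hs₀ ▸ coordForm_orientField_ne_zero hπ hθ o hy₀
  have hπc : ContinuousAt (fun y => π (φ.symm y)) y₀ :=
    (ContMDiffAt.comp y₀ hπ.contMDiff_proj.contMDiffAt (hsymm y₀ hy₀)).continuousAt
  filter_upwards [(isOpen_extChartAt_target p₀).mem_nhds hy₀,
    hπc.preimage_mem_nhds ((isOpen_extChartAt_source (I := 𝓡 n) x₀).mem_nhds hmem₀),
    hπc.eventually (ho x₀), eventually_sign_eq hcont hne, hcont.eventually_ne hne]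
    with y hy hy' hray hsign hney
  rw [← hs₀, ← hsign]
  let A : EuclideanSpace ℝ (Fin (n + 1)) →ₗ[ℝ] EuclideanSpace ℝ (Fin n) :=
    (mfderiv (𝓡 (n + 1)) (𝓡 n) π (φ.symm y)).toLinearMap.comp
      (mfderiv 𝓘(ℝ, EuclideanSpace ℝ (Fin (n + 1))) (𝓡 (n + 1)) φ.symm y).toLinearMap
  let O₁ : EuclideanSpace ℝ (Fin n) [⋀^Fin n]→ₗ[ℝ] ℝ := (o (π (φ.symm y))).someVector
  let B : EuclideanSpace ℝ (Fin n) →ₗ[ℝ] EuclideanSpace ℝ (Fin n) :=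
    (mfderiv (𝓡 n) 𝓘(ℝ, EuclideanSpace ℝ (Fin n)) (extChartAt (𝓡 n) x₀)
      (π (φ.symm y))).toLinearMap
  have hO₁ : O₁ ≠ 0 := (o (π (φ.symm y))).someVector_ne_zero
  have hray' : SameRay ℝ O₁ (O.compLinearMap B) := hray
  have hs : coordForm (orientField π θ o) p₀ y (eBasis (n + 1)) = (-1 : ℝ) ^ n *
      wedge (Nat.add_comm 1 n) (coordForm θ p₀ y) (O₁.compLinearMap A) (eBasis (n + 1)) :=
    coordForm_orientField_apply θ o p₀ y _
  have hss : s' y = (-1 : ℝ) ^ n * wedge (Nat.add_comm 1 n) (coordForm θ p₀ y)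
      ((O.compLinearMap B).compLinearMap A) (eBasis (n + 1)) := by
    have : O.compLinearMap (fderiv ℝ F y).toLinearMap = (O.compLinearMap B).compLinearMap A :=
      AlternatingMap.ext fun v => congrArg O (funext fun i => hFd y hy hy' (v i))
    simp only [s', this]
  rw [hss] at hney ⊢
  rw [hs]
  exact sign_wedge_of_sameRay _ _ _ hO₁ hray' hney

end Orientation

/-! ### The Hodge star and the Lie derivative -/

section HodgeStar

variable {n k l : ℕ} {M P : Type*}
  [TopologicalSpace M] [ChartedSpace (EuclideanSpace ℝ (Fin n)) M]
  [TopologicalSpace P] [ChartedSpace (EuclideanSpace ℝ (Fin (n + 1))) P]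
  {π : P → M} {g : TensorField (n + 1) P 2} {θ : FormField (n + 1) P 1}
  {o : ∀ x : M, Orientation ℝ (TangentSpace (𝓡 n) x) (Fin n)} {h : k + l = n + 1}

theorem isHodgeDual_iff {ξ : FormField (n + 1) P k} {ζ : FormField (n + 1) P l} :
    IsHodgeDual π g θ o h ξ ζ ↔ ∀ p, IsHodgeAt h (fun v w => lorentzMetric g θ p ![v, w])
      (stdBasis p) (orientForm π θ o p) (ξ p).toAlternatingMap (ζ p).toAlternatingMap :=
  ⟨fun H p η => H p (toForm η), fun H p η => H p η.toAlternatingMap⟩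

theorem exists_isHodgeDual (ξ : FormField (n + 1) P k) :
    ∃ ζ : FormField (n + 1) P l, IsHodgeDual π g θ o h ξ ζ := by
  choose ζ hζ using fun p => exists_isHodgeAt (l := l) h
    (fun v w => lorentzMetric g θ p ![v, w]) (stdBasis p) (orientForm π θ o p)
    (ξ p).toAlternatingMap
  exact ⟨fun p => toForm (ζ p), isHodgeDual_iff.mpr hζ⟩

theorem isHodgeDual_hodgeStar (ξ : FormField (n + 1) P k) :
    IsHodgeDual π g θ o h ξ (hodgeStar (l := l) π g θ o h ξ) :=
  Classical.epsilon_spec (exists_isHodgeDual ξ)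

theorem IsHodgeDual.unique {ξ : FormField (n + 1) P k} {ζ ζ' : FormField (n + 1) P l}
    (H : IsHodgeDual π g θ o h ξ ζ) (H' : IsHodgeDual π g θ o h ξ ζ') : ζ = ζ' :=
  funext fun p => ContinuousAlternatingMap.toAlternatingMap_injective
    ((isHodgeDual_iff.mp H p).unique (isHodgeDual_iff.mp H' p))

theorem IsHodgeDual.smul {ξ : FormField (n + 1) P k} {ζ : FormField (n + 1) P l}
    (H : IsHodgeDual π g θ o h ξ ζ) (c : ℝ) : IsHodgeDual π g θ o h (c • ξ) (c • ζ) :=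
  isHodgeDual_iff.mpr fun p => (isHodgeDual_iff.mp H p).smul c

theorem isHodgeDual_iff_eq_hodgeStar {ξ : FormField (n + 1) P k} {ζ : FormField (n + 1) P l} :
    IsHodgeDual π g θ o h ξ ζ ↔ ζ = hodgeStar π g θ o h ξ :=
  ⟨fun H => H.unique (isHodgeDual_hodgeStar ξ), fun H => H ▸ isHodgeDual_hodgeStar ξ⟩

variable [IsManifold (𝓡 (n + 1)) ∞ P]

/-- A covariant `2`-tensor field in a chart, as a function of two vectors, after a change of
frame `A`. -/
def coordMetric {m : ℕ} {Q : Type*} [TopologicalSpace Q]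
    [ChartedSpace (EuclideanSpace ℝ (Fin m)) Q] (G : TensorField m Q 2) (p₀ : Q)
    (y : EuclideanSpace ℝ (Fin m)) (A : EuclideanSpace ℝ (Fin m) →ₗ[ℝ] EuclideanSpace ℝ (Fin m))
    (v w : EuclideanSpace ℝ (Fin m)) : ℝ :=
  coordTensor G p₀ y ![A v, A w]

theorem coordTensor_pair {m : ℕ} {Q : Type*} [TopologicalSpace Q]
    [ChartedSpace (EuclideanSpace ℝ (Fin m)) Q] (G : TensorField m Q 2) (p₀ : Q)
    (y v w : EuclideanSpace ℝ (Fin m)) :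
    coordTensor G p₀ y ![v, w] = G ((extChartAt (𝓡 m) p₀).symm y)
      ![mfderiv 𝓘(ℝ, EuclideanSpace ℝ (Fin m)) (𝓡 m) (extChartAt (𝓡 m) p₀).symm y v,
        mfderiv 𝓘(ℝ, EuclideanSpace ℝ (Fin m)) (𝓡 m) (extChartAt (𝓡 m) p₀).symm y w] := by
  refine congrArg (G _) (funext fun i => ?_)
  fin_cases i <;> rfl

/-- The Hodge dual in a chart, in an arbitrary frame. -/
theorem IsHodgeDual.coord {ξ : FormField (n + 1) P k} {ζ : FormField (n + 1) P l}
    (H : IsHodgeDual π g θ o h ξ ζ) {p₀ : P} {y : EuclideanSpace ℝ (Fin (n + 1))}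
    (hy : y ∈ (extChartAt (𝓡 (n + 1)) p₀).target)
    {A : EuclideanSpace ℝ (Fin (n + 1)) →ₗ[ℝ] EuclideanSpace ℝ (Fin (n + 1))}
    (hA : IsUnit (LinearMap.det A)) :
    IsHodgeAt h (coordMetric (lorentzMetric g θ) p₀ y A) (eBasis (n + 1))
      ((coordForm (orientField π θ o) p₀ y).compLinearMap A)
      ((coordForm ξ p₀ y).compLinearMap A) ((coordForm ζ p₀ y).compLinearMap A) := by
  have h1 := (isHodgeDual_iff.mp H ((extChartAt (𝓡 (n + 1)) p₀).symm y)).pullback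
    (β := tensorBilin (lorentzMetric g θ _)) (fun _ _ => rfl) (eBasis (n + 1))
    ((LinearEquiv.ofIsUnitDet (v := eBasis (n + 1)) (v' := eBasis (n + 1)) (f := A)
      (by rwa [LinearMap.det_toMatrix])).trans (chartEquiv hy))
  have h2 : coordMetric (lorentzMetric g θ) p₀ y A = fun v w => _ :=
    funext fun v => funext fun w => coordTensor_pair (lorentzMetric g θ) p₀ y (A v) (A w)
  rw [h2]
  exact h1

theorem det_gram_coordMetric_ne_zero [MulAction ℝˣ P] (hπ : IsPrincipalBundle n π)
    (hg : IsCarrollianMetric π g) (hθ : IsConnectionForm θ) {p₀ : P}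
    {y : EuclideanSpace ℝ (Fin (n + 1))} (hy : y ∈ (extChartAt (𝓡 (n + 1)) p₀).target) :
    (gram (coordMetric (lorentzMetric g θ) p₀ y LinearMap.id) (eBasis (n + 1))).det ≠ 0 := by
  have h1 := det_gram_lorentzMetric_ne_zero hπ hg hθ ((extChartAt (𝓡 (n + 1)) p₀).symm y)
    ((eBasis (n + 1)).map (chartEquiv hy))
  have h2 : gram (coordMetric (lorentzMetric g θ) p₀ y LinearMap.id) (eBasis (n + 1)) =
      gram (fun v w => lorentzMetric g θ _ ![v, w]) ((eBasis (n + 1)).map (chartEquiv hy)) := by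
    ext i j
    simp only [gram, Matrix.of_apply, Module.Basis.map_apply]
    exact coordTensor_pair (lorentzMetric g θ) p₀ y _ _
  rwa [h2]

omit [IsManifold (𝓡 (n + 1)) ∞ P] in
theorem lorentzMetric_smooth (hg : g.Smooth) (hθ : θ.Smooth) : (lorentzMetric g θ).Smooth := by
  intro p₀
  refine contDiffOn_of_components fun f => ?_
  have h1 : ∀ y, coordTensor (lorentzMetric g θ) p₀ y (eBasis (n + 1) ∘ f) =
      coordTensor g p₀ y (eBasis (n + 1) ∘ f) -
        coordTensor θ.toTensor p₀ y (fun _ => eBasis (n + 1) (f 0)) *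
          coordTensor θ.toTensor p₀ y (fun _ => eBasis (n + 1) (f 1)) := by
    intro y
    have h2 : ∀ w : Fin 2 → EuclideanSpace ℝ (Fin (n + 1)), coordTensor (tensorSq θ) p₀ y w =
        ∏ i, coordTensor θ.toTensor p₀ y (fun _ => w i) := fun w => rfl
    have h3 := h2 (eBasis (n + 1) ∘ f)
    rw [Fin.prod_univ_two] at h3
    exact congrArg (fun z => coordTensor g p₀ y (eBasis (n + 1) ∘ f) - z) h3
  simp only [h1]
  exact (contDiffOn_tensor_apply (hg p₀) _).sub
    ((contDiffOn_tensor_apply (hθ p₀) _).mul (contDiffOn_tensor_apply (hθ p₀) _))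

/-- `L_Δ G = 0`. -/
theorem isKilling_lorentzMetric [MulAction ℝˣ P]
    (hs : ContMDiff (𝓘(ℝ, ℝ).prod (𝓡 (n + 1))) (𝓡 (n + 1)) ∞ (fun a : ℝˣ × P => a.1 • a.2))
    (hg : g.Smooth) (hθ : IsConnectionForm θ) (hK : IsKilling (euler n P) g) :
    IsKilling (euler n P) (lorentzMetric g θ) := by
  have hL := lieDeriv_euler_connection hs hθ
  funext p
  ext w
  suffices H : ∀ w : Fin 2 → EuclideanSpace ℝ (Fin (n + 1)),
      lieDeriv (euler n P) (lorentzMetric g θ) p w = 0 from H w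
  clear w
  intro w
  have h1 := (lorentzMetric_smooth hg hθ.smooth).hasDerivAt_lieDeriv (euler n P) p w
  have h2 : HasDerivAt _ (0 : ℝ) (0 : ℝ) := (hg.hasDerivAt_lieDeriv (euler n P) p w).congr_deriv
    (congrArg (fun T : TensorField (n + 1) P 2 => T p w) hK)
  have h3 : ∀ w : Fin 1 → EuclideanSpace ℝ (Fin (n + 1)), HasDerivAt _ (0 : ℝ) (0 : ℝ) := fun w =>
    (hθ.smooth.hasDerivAt_lieDeriv (euler n P) p w).congr_deriv
      (congrArg (fun T : TensorField (n + 1) P 1 => T p w) hL)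
  have h4 := h2.sub ((h3 fun _ => w 0).mul (h3 fun _ => w 1))
  refine h1.unique (HasDerivAt.congr_deriv (h4.congr_of_eventuallyEq (Filter.Eventually.of_forall
    fun t => ?_)) (by simp))
  have h5 : ∀ (y : EuclideanSpace ℝ (Fin (n + 1))) (w : Fin 2 → EuclideanSpace ℝ (Fin (n + 1))),
      coordTensor (lorentzMetric g θ) p y w = coordTensor g p y w -
        ∏ i, coordTensor θ.toTensor p y (fun _ => w i) := fun y w => rfl
  refine (h5 _ _).trans ?_
  rw [Fin.prod_univ_two]
  rfl

variable [IsManifold (𝓡 n) ∞ M] [MulAction ℝˣ P]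

/-- The Hodge dual of a smooth form is smooth. -/
theorem IsHodgeDual.smooth (hπ : IsPrincipalBundle n π) (ho : IsManifoldOrientation o)
    (hg : IsCarrollianMetric π g) (hθ : IsConnectionForm θ)
    {ξ : FormField (n + 1) P k} {ζ : FormField (n + 1) P l}
    (H : IsHodgeDual π g θ o h ξ ζ) (hξ : ξ.Smooth) : ζ.Smooth := by
  intro p₀
  refine contDiffOn_of_components fun f y hy => ContDiffAt.contDiffWithinAt ?_
  have hgram : ContDiffAt ℝ ∞ (fun y i j => gram (coordMetric (lorentzMetric g θ) p₀ y
      LinearMap.id) (eBasis (n + 1)) i j) y :=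
    contDiffAt_pi.mpr fun i => contDiffAt_pi.mpr fun j =>
      (contDiffOn_tensor_apply (lorentzMetric_smooth hg.smooth hθ.smooth p₀) _).contDiffAt
        ((isOpen_extChartAt_target p₀).mem_nhds hy)
  have hdet := det_gram_coordMetric_ne_zero hπ hg hθ hy
  have h1 := (contDiffAt_formInner (ξ := fun y => coordForm ξ p₀ y) hgram hdet
    (fun f => (contDiffOn_tensor_apply (hξ p₀) _).contDiffAt
      ((isOpen_extChartAt_target p₀).mem_nhds hy))
    (contractRight h (eBasis (n + 1)).det (eBasis (n + 1) ∘ f))).mul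
    ((contDiffAt_sqrt_det hgram hdet).mul (contDiffAt_const (c :=
      coordForm (orientField π θ o) p₀ y (eBasis (n + 1)) /
        |coordForm (orientField π θ o) p₀ y (eBasis (n + 1))|)))
  refine h1.congr_of_eventuallyEq ?_
  filter_upwards [(isOpen_extChartAt_target p₀).mem_nhds hy,
    eventually_orientSign hπ hθ ho hy] with y' hy' hs
  rw [← hs]
  exact (H.coord hy' (A := LinearMap.id) (by simp)).apply_basis f

/-- Hodge duality commutes with the Lie derivative along a Killing field.  In a chart at `p`, both
are computed by moving, to first order in `t`, along the flow of `X`; the forms pulled back to `p`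
stay Hodge dual for the pulled back metric, which is constant to first order. -/
theorem IsHodgeDual.lieDeriv (hπ : IsPrincipalBundle n π) (ho : IsManifoldOrientation o)
    (hg : IsCarrollianMetric π g) (hθ : IsConnectionForm θ) {X : VField (n + 1) P}
    (hX : IsKilling X (lorentzMetric g θ))
    {ξ : FormField (n + 1) P k} {ζ : FormField (n + 1) P l}
    (H : IsHodgeDual π g θ o h ξ ζ) (hξ : ξ.Smooth) :
    IsHodgeDual π g θ o h (lieDerivForm X ξ) (lieDerivForm X ζ) := by
  have hζ := H.smooth hπ ho hg hθ hξ
  have hGs := lorentzMetric_smooth hg.smooth hθ.smooth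
  refine isHodgeDual_iff.mpr fun p => isHodgeAt_of_apply_basis fun f => ?_
  set y := extChartAt (𝓡 (n + 1)) p p
  set V := coordVField X p
  have hy : y ∈ (extChartAt (𝓡 (n + 1)) p).target := mem_extChartAt_target p
  set e := eBasis (n + 1)
  let A : ℝ → EuclideanSpace ℝ (Fin (n + 1)) →ₗ[ℝ] EuclideanSpace ℝ (Fin (n + 1)) :=
    fun t => LinearMap.id + t • (fderiv ℝ V y).toLinearMap
  let s : EuclideanSpace ℝ (Fin (n + 1)) → ℝ := fun y => coordForm (orientField π θ o) p y e
  have hA0 : A 0 = LinearMap.id := by simp [A]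
  have hder : ∀ {j : ℕ} {T : TensorField (n + 1) P j}, T.Smooth →
      ∀ w : Fin j → EuclideanSpace ℝ (Fin (n + 1)),
      HasDerivAt (fun t : ℝ => coordTensor T p (y + t • V y) fun i => A t (w i))
        (Carroll.lieDeriv X T p w) 0 := fun hT w => hT.hasDerivAt_lieDeriv X p w
  let B : ℝ → EuclideanSpace ℝ (Fin (n + 1)) → EuclideanSpace ℝ (Fin (n + 1)) → ℝ :=
    fun t => coordMetric (lorentzMetric g θ) p (y + t • V y) (A t)
  have hB : ∀ i j, HasDerivAt (fun t => B t (e i) (e j)) 0 0 := by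
    intro i j
    have h1 := hder hGs ![e i, e j]
    rw [hX] at h1
    refine h1.congr_of_eventuallyEq (Filter.Eventually.of_forall fun t => ?_)
    refine congrArg (coordTensor (lorentzMetric g θ) p (y + t • V y)) (funext fun a => ?_)
    fin_cases a <;> rfl
  have hB0 : B 0 = coordMetric (lorentzMetric g θ) p y LinearMap.id := by
    simp only [B, hA0, zero_smul, add_zero]
  have hdet : (gram (B 0) e).det ≠ 0 := hB0 ▸ det_gram_coordMetric_ne_zero hπ hg hθ hy
  -- both sides of the component formula for the Hodge dual along the curve, and their derivatives
  have hlhs := hder hζ (e ∘ f)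
  have hrhs := (hasDerivAt_formInner
    (ξ := fun t => (coordForm ξ p (y + t • V y)).compLinearMap (A t))
    (ξ' := (show EuclideanSpace ℝ (Fin (n + 1)) [⋀^Fin k]→ₗ[ℝ] ℝ from
      (lieDerivForm X ξ p).toAlternatingMap)) hB hdet (fun f => hder hξ (e ∘ f))
    (contractRight h e.det (e ∘ f))).mul
      ((hasDerivAt_sqrt_det hB hdet).mul_const (s y / |s y|))
  have hcurve : ContinuousAt (fun t : ℝ => y + t • V y) 0 := (hasDerivAt_line _ _).continuousAt
  have hev : (fun t : ℝ => coordTensor ζ.toTensor p (y + t • V y) fun i => A t ((e ∘ f) i))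
      =ᶠ[nhds 0] fun t => formInner (B t) e (contractRight h e.det (e ∘ f))
        ((coordForm ξ p (y + t • V y)).compLinearMap (A t)) *
          (√|(gram (B t) e).det| * (s y / |s y|)) := by
    have hy0 : y + (0 : ℝ) • V y = y := by simp
    -- `A t` is invertible and preserves orientations for small `t`
    have hdetA : ∀ᶠ t in nhds (0 : ℝ), 0 < e.det fun i => A t (e i) := by
      have hc : ContinuousAt (fun t => e.det fun i => A t (e i)) 0 :=
        (multilinear_continuous e.det.toMultilinearMap).continuousAt.comp
          (f := fun (t : ℝ) i => A t (e i))
          (tendsto_pi_nhds.mpr fun i => (hasDerivAt_line _ _).continuousAt)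
      refine hc.eventually (lt_mem_nhds ?_)
      simp only [hA0, LinearMap.id_apply]
      rw [e.det_self]
      exact one_pos
    have hsign := eventually_orientSign hπ hθ ho hy
    rw [← hy0] at hsign
    have htarget : ∀ᶠ t in nhds (0 : ℝ), y + t • V y ∈ (extChartAt (𝓡 (n + 1)) p).target :=
      hcurve.preimage_mem_nhds ((isOpen_extChartAt_target p).mem_nhds (by rwa [hy0]))
    filter_upwards [hdetA, htarget, hcurve.eventually hsign] with t ht hyt hst
    have hunit : IsUnit (LinearMap.det (A t)) := by
      have h1 := e.det_comp (A t) e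
      rw [e.det_self, mul_one] at h1
      rw [← h1]
      exact ht.ne'.isUnit
    refine ((H.coord hyt hunit).apply_basis f).trans ?_
    have h2 : (coordForm (orientField π θ o) p (y + t • V y)).compLinearMap (A t) e =
        (e.det fun i => A t (e i)) * s (y + t • V y) := by
      change coordForm (orientField π θ o) p (y + t • V y) (fun i => A t (e i)) = _
      rw [(coordForm (orientField π θ o) p (y + t • V y)).eq_smul_basis_det e]
      simp only [AlternatingMap.smul_apply, smul_eq_mul]
      rw [mul_comm]
    have h3 : s (y + t • V y) / |s (y + t • V y)| = s y / |s y| := by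
      rw [hy0] at hst
      exact hst
    rw [h2, ← h3, div_abs_eq_of_pos one_pos ht (one_mul _)]
  have hfin := hlhs.unique (hrhs.congr_of_eventuallyEq hev)
  rw [zero_mul, mul_zero, add_zero, hB0] at hfin
  have h4 : coordMetric (lorentzMetric g θ) p y LinearMap.id =
      fun v w => lorentzMetric g θ p ![v, w] :=
    funext fun v => funext fun w => coordTensor_self (lorentzMetric g θ) p ![v, w]
  have h5 : s y = orientForm π θ o p (stdBasis p) :=
    coordTensor_self (orientField π θ o).toTensor p (stdBasis p)
  rw [h4, h5] at hfin
  exact hfin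

end HodgeStar
end

end Carroll

theorem mainTheorem2 (n : ℕ) {M P : Type*}
    [TopologicalSpace M] [T2Space M] [SecondCountableTopology M]
    [ChartedSpace (EuclideanSpace ℝ (Fin n)) M] [IsManifold (𝓡 n) ∞ M]
    [TopologicalSpace P] [T2Space P] [SecondCountableTopology P]
    [ChartedSpace (EuclideanSpace ℝ (Fin (n + 1))) P] [IsManifold (𝓡 (n + 1)) ∞ P]
    [MulAction ℝˣ P] (π : P → M) (hπ : Carroll.IsPrincipalBundle n π)
    (o : ∀ x : M, Orientation ℝ (TangentSpace (𝓡 n) x) (Fin n))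
    (ho : Carroll.IsManifoldOrientation o)
    (g : Carroll.TensorField (n + 1) P 2) (hg : Carroll.IsCarrollianMetric π g)
    (θ : Carroll.FormField (n + 1) P 1) (hθ : Carroll.IsConnectionForm θ)
    (hK : Carroll.IsKilling (Carroll.euler n P) g) :
    Carroll.IsKilling (Carroll.euler n P) (Carroll.lorentzMetric g θ) ∧
    ∀ (k l : ℕ) (h : k + l = n + 1) (ξ : Carroll.FormField (n + 1) P k), ξ.Smooth →
      (∀ ζ : Carroll.FormField (n + 1) P l,
        Carroll.IsHodgeDual π g θ o h ξ ζ ↔ ζ = Carroll.hodgeStar π g θ o h ξ) ∧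
      (Carroll.hodgeStar π g θ o h ξ).Smooth ∧
      Carroll.lieDerivForm (Carroll.euler n P) (Carroll.hodgeStar π g θ o h ξ) =
        Carroll.hodgeStar π g θ o h (Carroll.lieDerivForm (Carroll.euler n P) ξ) ∧
      ∀ c : ℝ, Carroll.IsHomogeneous (Carroll.euler n P) c ξ →
        Carroll.IsHomogeneous (Carroll.euler n P) c (Carroll.hodgeStar π g θ o h ξ) := by
  have hG := Carroll.isKilling_lorentzMetric hπ.smooth_smul hg.smooth hθ hK
  refine ⟨hG, fun k l h ξ hξ => ?_⟩
  have H := Carroll.isHodgeDual_hodgeStar (l := l) (π := π) (g := g) (θ := θ) (o := o) (h := h) ξ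
  have hL := H.lieDeriv hπ ho hg hθ hG hξ
  refine ⟨fun ζ => Carroll.isHodgeDual_iff_eq_hodgeStar, H.smooth hπ ho hg hθ hξ,
    Carroll.isHodgeDual_iff_eq_hodgeStar.mp hL, fun c hc => ?_⟩
  rw [Carroll.IsHomogeneous] at hc
  rw [hc] at hL
  exact hL.unique (H.smul c)
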